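/- Let $(\Omega,\mathcal F,\mathbb P)$ be a probability space, let $H\in(0,1)$, $\alpha\in[1,2)$, and let $\widetilde M_\alpha$ be a complex-valued rotationally invariant $\alpha$-stable random measure on $\mathbb R$ with Lebesgue control measure; that is, $\widetilde M_\alpha$ assigns to each Borel set $A\subseteq\mathbb R$ of finite Lebesgue measure $|A|$ a complex random variable with $$\mathbb E\,e^{i\,\mathrm{Re}(\bar z\,\widetilde M_\alpha(A))}=e^{-|A|\,|z|^\alpha}\qquad(z\in\mathbb C),$$ its values on finitely many pairwise disjoint sets are independent, and, for every sequence $(A_n)_{n\ge 1}$ of pairwise disjoint Borel sets whose union has finite measure, $\widetilde M_\alpha\big(\bigcup_n A_n\big)=\lim_{N\to\infty}\sum_{n\le N}\widetilde M_\alpha(A_n)$ almost surely. For $f\in L^\alpha(\mathbb R;\mathbb C)$, $\int_{\mathbb R} f\,d\widetilde M_\alpha$ denotes the limit in probability of the integrals $\sum_c c\,\widetilde M_\alpha(\{s_n=c\})$ of simple functions $s_n$, supported on sets of finite measure, with $s_n\to f$ in $L^\alpha$. Let $X=\{X(t),\,t\in\mathbb R\}$ be the harmonizable fractional stable motion, that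 is, the real-valued process with almost surely continuous paths such that, for every $t\in\mathbb R$, almost surely $$X(t)=\mathrm{Re}\left(\int_{\mathbb R}\frac{e^{it\xi}-1}{|\xi|^{H+1/\alpha}}\,d\widetilde M_\alpha(\xi)\right).$$ Then, for all $\delta>0$ and $\widetilde\rho>0$, almost surely $$\sup_{-\widetilde\rho\le t'<t''\le\widetilde\rho}\ \frac{|X(t')-X(t'')|}{|t'-t''|^{H}\,\big(\log(1+|t'-t''|^{-1})\big)^{1/\alpha+\delta}}<+\infty .$$ -/

import Mathlib

open MeasureTheory ProbabilityTheory Filter Topology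
open scoped ENNReal

/-- `IsIsotropicStableRandomMeasure α m P M`: on the probability space `(Ω, P)`, the family `M A`,
indexed by the measurable sets `A` with `m A < ∞`, is a complex-valued rotationally invariant
`α`-stable random measure with control measure `m`: each `M A` is a rotationally invariant
`α`-stable complex random variable whose characteristic function is `z ↦ exp (-m A * ‖z‖ ^ α)`,
and `M` is independently scattered and almost surely `σ`-additive. The values of `M` at other
sets are irrelevant.

The sum in the last field is the limit of the partial sums: for `1 ≤ α` the series
need not converge absolutely. -/
structure IsIsotropicStableRandomMeasure {E Ω : Type*} [MeasurableSpace E] [MeasurableSpace Ω]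
    (α : ℝ) (m : Measure E) (P : Measure Ω) (M : Set E → Ω → ℂ) : Prop where
  measurable : ∀ A : Set E, MeasurableSet A → m A < ∞ → Measurable (M A)
  charFun_eq : ∀ A : Set E, MeasurableSet A → m A < ∞ → ∀ z : ℂ,
    charFun (P.map (M A)) z = ((Real.exp (-((m A).toReal * ‖z‖ ^ α)) : ℝ) : ℂ)
  indep : ∀ (n : ℕ) (A : Fin n → Set E), (∀ i, MeasurableSet (A i)) → (∀ i, m (A i) < ∞) →
    (∀ i j, i ≠ j → Disjoint (A i) (A j)) → iIndepFun (fun i => M (A i)) P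
  sigma_additive : ∀ A : ℕ → Set E, (∀ i, MeasurableSet (A i)) → m (⋃ i, A i) < ∞ →
    (∀ i j, i ≠ j → Disjoint (A i) (A j)) →
    ∀ᵐ ω ∂P, Tendsto (fun n => ∑ i ∈ Finset.range n, M (A i) ω) atTop (𝓝 (M (⋃ i, A i) ω))

/-- The integral `∑ c, c * M {s = c}` of a simple function `s`. The value `c = 0`, for which
`{s = 0}` may have infinite control measure, contributes `0`. -/
noncomputable def simpleStableIntegral {E Ω : Type*} [MeasurableSpace E]
    (M : Set E → Ω → ℂ) (s : SimpleFunc E ℂ) (ω : Ω) : ℂ :=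
  ∑ c ∈ s.range, c * M (s ⁻¹' {c}) ω

/-- `IsStableIntegral α m P M f J`: the random variable `J` is (a version of) the stochastic
integral `∫ f dM` of the function `f ∈ L^α(m)`, that is, the limit in probability of the integrals
of simple functions (vanishing off a set of finite measure) that converge to `f` in `L^α(m)`. -/
def IsStableIntegral {E Ω : Type*} [MeasurableSpace E] [MeasurableSpace Ω]
    (α : ℝ) (m : Measure E) (P : Measure Ω) (M : Set E → Ω → ℂ) (f : E → ℂ) (J : Ω → ℂ) : Prop :=
  ∃ s : ℕ → SimpleFunc E ℂ, (∀ n, (s n).FinMeasSupp m) ∧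
    Tendsto (fun n => eLpNorm (fun x => s n x - f x) (ENNReal.ofReal α) m) atTop (𝓝 0) ∧
    TendstoInMeasure P (fun n => simpleStableIntegral M (s n)) atTop J

/-- The kernel `(e^{itξ} - 1) / |ξ|^{H + 1/α}`. -/
noncomputable def hfsmKernel (H α t ξ : ℝ) : ℂ :=
  (Complex.exp (Complex.I * (t : ℂ) * (ξ : ℂ)) - 1) / ((|ξ| ^ (H + 1 / α) : ℝ) : ℂ)

/-- `X` is the harmonizable fractional stable motion with parameters `H` and `α` driven by the
random measure `M`: for every `t`, almost surely `X t = Re ∫ (e^{itξ} - 1) / |ξ|^{H + 1/α} dM(ξ)`,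
where `M` is a rotationally invariant `α`-stable random measure with Lebesgue control measure,
and `X` has almost surely continuous paths. -/
structure IsHFSM {Ω : Type*} [MeasurableSpace Ω] (H α : ℝ) (P : Measure Ω)
    (M : Set ℝ → Ω → ℂ) (X : ℝ → Ω → ℝ) : Prop where
  randomMeasure : IsIsotropicStableRandomMeasure α volume P M
  eq_integral : ∀ t : ℝ, ∃ J : Ω → ℂ,
    IsStableIntegral α volume P M (hfsmKernel H α t) J ∧ ∀ᵐ ω ∂P, X t ω = (J ω).re
  continuous : ∀ᵐ ω ∂P, Continuous fun t => X t ω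

/-!
The path is chained along the dyadic points, so by Borel-Cantelli it suffices that the probability
that one of the `O(2ⁿ)` increments of step `2⁻ⁿ` exceeds a constant times
`y = 2^(-nH) n^(1/α + δ)` is summable in `n`. A union bound is of no use here, because the
increments have tails of order `x ^ (-α)` only.

Approximating all these increments by integrals of simple functions at once, we may think of them as
sums of the same independent symmetric jumps, each increment with coefficients of its own, the sizes
of the jumps being governed by a common envelope of the kernels, of `L^α` norm of order `2^(-nH)`.
* A jump above `y` occurs with probability of order `(2^(-nH) / y) ^ α = n^(-1 - αδ)`, which is
  summable, and this does not depend on the number of increments.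
* The jumps below `y / (3n)` have a compensated sum by symmetry, and Chernoff's bound `e^(-3n)`
  outweighs the `O(2ⁿ)` increments.
* The jumps in between are so few that, up to a probability of order `n^(-2)`, their sizes add up to
  at most a constant times `y`.
-/

section BoundedSums

lemma lintegral_Ioc_ofReal_mul_rpow {q τ p : ℝ} (hq : 0 ≤ q) (hτ : 0 ≤ τ) (hp : -1 < p) :
    ∫⁻ t in Set.Ioc 0 τ, ENNReal.ofReal (q * t ^ p) =
      ENNReal.ofReal (q * (τ ^ (p + 1) / (p + 1))) := by
  rw [← ofReal_integral_eq_lintegral_ofReal]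
  · rw [← intervalIntegral.integral_of_le hτ, intervalIntegral.integral_const_mul,
      integral_rpow (Or.inl hp), Real.zero_rpow (by linarith), sub_zero]
  · rw [← IntegrableOn, ← intervalIntegrable_iff_integrableOn_Ioc_of_le hτ]
    exact (intervalIntegral.intervalIntegrable_rpow' hp).const_mul q
  · filter_upwards [ae_restrict_mem measurableSet_Ioc] with t ht
    have := ht.1
    positivity

variable {Ω : Type*} [MeasurableSpace Ω] {P : Measure Ω}

lemma integral_min_sq_le_of_tail_le [IsFiniteMeasure P] {α q τ : ℝ} (hα : α < 2) (hτ : 0 < τ)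
    {Y : Ω → ℝ} (hY : Measurable Y) (hY0 : ∀ ω, 0 ≤ Y ω)
    (htail : ∀ x, 0 < x → P.real {ω | x < Y ω} ≤ q * x ^ (-α)) :
    ∫ ω, min (Y ω) τ ^ 2 ∂P ≤ 2 / (2 - α) * q * τ ^ (2 - α) := by
  have hα' : 0 < 2 - α := by linarith
  have hq : 0 ≤ q := by simpa using measureReal_nonneg.trans (htail 1 one_pos)
  have hVm : Measurable fun ω => min (Y ω) τ := hY.min measurable_const
  have hV0 : ∀ ω, 0 ≤ min (Y ω) τ := fun ω => le_min (hY0 ω) hτ.le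
  have hlayer : ∀ t ∈ Set.Ioi (0 : ℝ),
      P {ω | t < min (Y ω) τ} * ENNReal.ofReal (t ^ ((2 : ℝ) - 1)) ≤
        (Set.Ioc 0 τ).indicator (fun t => ENNReal.ofReal (q * t ^ (1 - α))) t := by
    intro t (ht : 0 < t)
    rcases le_or_gt t τ with htτ | htτ
    · rw [Set.indicator_of_mem (show t ∈ Set.Ioc 0 τ from ⟨ht, htτ⟩)]
      have hP : P {ω | t < min (Y ω) τ} ≤ ENNReal.ofReal (q * t ^ (-α)) := by
        rw [← ofReal_measureReal]
        exact ENNReal.ofReal_le_ofReal ((measureReal_mono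
          fun ω (hω : t < min (Y ω) τ) => hω.trans_le (min_le_left _ _)).trans (htail t ht))
      calc P {ω | t < min (Y ω) τ} * ENNReal.ofReal (t ^ ((2 : ℝ) - 1))
          ≤ ENNReal.ofReal (q * t ^ (-α)) * ENNReal.ofReal (t ^ ((2 : ℝ) - 1)) := by gcongr
        _ = ENNReal.ofReal (q * t ^ (1 - α)) := by
          rw [← ENNReal.ofReal_mul (by positivity), mul_assoc, ← Real.rpow_add ht]
          ring_nf
    · simp [not_lt.2 htτ.le]
  rw [integral_eq_lintegral_of_nonneg_ae (ae_of_all _ fun ω => sq_nonneg _)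
    (hVm.pow_const 2).aestronglyMeasurable]
  refine ENNReal.toReal_le_of_le_ofReal (by positivity) ?_
  simp only [← Real.rpow_two]
  rw [lintegral_rpow_eq_lintegral_meas_lt_mul P (ae_of_all _ hV0) hVm.aemeasurable two_pos]
  calc ENNReal.ofReal 2 *
        ∫⁻ t in Set.Ioi 0, P {ω | t < min (Y ω) τ} * ENNReal.ofReal (t ^ ((2 : ℝ) - 1))
      ≤ ENNReal.ofReal 2 * ENNReal.ofReal (q * (τ ^ (1 - α + 1) / (1 - α + 1))) := by
        grw [setLIntegral_mono' measurableSet_Ioi hlayer, setLIntegral_indicator measurableSet_Ioc,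
          Set.inter_eq_left.2 Set.Ioc_subset_Ioi_self,
          lintegral_Ioc_ofReal_mul_rpow hq hτ.le (by linarith)]
    _ = ENNReal.ofReal (2 / (2 - α) * q * τ ^ (2 - α)) := by
        rw [← ENNReal.ofReal_mul (by norm_num), show 1 - α + 1 = 2 - α by ring]
        ring_nf

lemma integrable_exp_mul_of_abs_le [IsFiniteMeasure P] {b t : ℝ} {V : Ω → ℝ} (hV : Measurable V)
    (hVb : ∀ ω, |V ω| ≤ b) : Integrable (fun ω => Real.exp (t * V ω)) P :=
  integrable_exp_mul_of_mem_Icc hV.aemeasurable (ae_of_all _ fun ω => abs_le.1 (hVb ω))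

lemma mgf_inv_le_exp_of_abs_le [IsProbabilityMeasure P] {τ v : ℝ} (hτ : 0 < τ) {V : Ω → ℝ}
    (hV : Measurable V) (hVτ : ∀ ω, |V ω| ≤ τ) (hmean : ∫ ω, V ω ∂P = 0)
    (hv : ∫ ω, V ω ^ 2 ∂P ≤ v) : mgf V P τ⁻¹ ≤ Real.exp (v / τ ^ 2) := by
  have hV1 : Integrable (fun ω => τ⁻¹ * V ω) P :=
    (Integrable.of_bound hV.aestronglyMeasurable τ (ae_of_all _ hVτ)).const_mul _
  have hV2 : Integrable (fun ω => (τ ^ 2)⁻¹ * V ω ^ 2) P := by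
    refine (Integrable.of_bound (hV.pow_const 2).aestronglyMeasurable (τ ^ 2)
      (ae_of_all _ fun ω => ?_)).const_mul _
    simpa using pow_le_pow_left₀ (abs_nonneg _) (hVτ ω) 2
  have hV01 : Integrable (fun ω => 1 + τ⁻¹ * V ω) P := (integrable_const _).add hV1
  have hexp : ∀ ω, Real.exp (τ⁻¹ * V ω) ≤ 1 + τ⁻¹ * V ω + (τ ^ 2)⁻¹ * V ω ^ 2 := by
    intro ω
    have h1 : |τ⁻¹ * V ω| ≤ 1 := by
      rw [abs_mul, abs_of_pos (inv_pos.2 hτ), inv_mul_le_iff₀ hτ, mul_one]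
      exact hVτ ω
    have h2 := (le_abs_self _).trans (Real.abs_exp_sub_one_sub_id_le h1)
    rw [mul_pow, inv_pow] at h2
    linarith
  calc mgf V P τ⁻¹ ≤ ∫ ω, (1 + τ⁻¹ * V ω + (τ ^ 2)⁻¹ * V ω ^ 2) ∂P :=
        integral_mono_of_nonneg (ae_of_all _ fun ω => (Real.exp_pos _).le)
          (hV01.add hV2) (ae_of_all _ hexp)
    _ = 1 + (∫ ω, V ω ^ 2 ∂P) / τ ^ 2 := by
        rw [integral_add hV01 hV2, integral_add (integrable_const _) hV1,
          integral_const_mul, integral_const_mul, hmean]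
        simp [div_eq_inv_mul]
    _ ≤ 1 + v / τ ^ 2 := by gcongr
    _ ≤ Real.exp (v / τ ^ 2) := by linarith [Real.add_one_le_exp (v / τ ^ 2)]

lemma exp_mul_le_one_add_mul (θ : ℝ) {u : ℝ} (hu0 : 0 ≤ u) (hu1 : u ≤ 1) :
    Real.exp (θ * u) ≤ 1 + (Real.exp θ - 1) * u := by
  have h := convexOn_exp.2 (Set.mem_univ 0) (Set.mem_univ θ) (sub_nonneg.2 hu1) hu0
    (sub_add_cancel 1 u)
  simp only [smul_eq_mul, mul_zero, zero_add, Real.exp_zero, mul_one] at h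
  rw [mul_comm θ]
  linarith

lemma mgf_div_le_exp_of_nonneg_of_le [IsProbabilityMeasure P] {y : ℝ} (θ : ℝ) (hy : 0 < y)
    {W : Ω → ℝ} (hW : Measurable W) (hW0 : ∀ ω, 0 ≤ W ω) (hWy : ∀ ω, W ω ≤ y) :
    mgf W P (θ / y) ≤ Real.exp ((Real.exp θ - 1) * ((∫ ω, W ω ∂P) / y)) := by
  have hWint : Integrable (fun ω => (Real.exp θ - 1) * (W ω / y)) P :=
    ((Integrable.of_mem_Icc 0 y hW.aemeasurable
      (ae_of_all _ fun ω => ⟨hW0 ω, hWy ω⟩)).div_const y).const_mul _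
  have hexp : ∀ ω, Real.exp (θ / y * W ω) ≤ 1 + (Real.exp θ - 1) * (W ω / y) := fun ω => by
    rw [div_mul_eq_mul_div, mul_div_assoc]
    exact exp_mul_le_one_add_mul θ (div_nonneg (hW0 ω) hy.le) ((div_le_one hy).2 (hWy ω))
  calc mgf W P (θ / y) ≤ ∫ ω, (1 + (Real.exp θ - 1) * (W ω / y)) ∂P :=
        integral_mono_of_nonneg (ae_of_all _ fun ω => (Real.exp_pos _).le)
          ((integrable_const _).add hWint) (ae_of_all _ hexp)
    _ = (Real.exp θ - 1) * ((∫ ω, W ω ∂P) / y) + 1 := by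
        rw [integral_add (integrable_const _) hWint, integral_const_mul, integral_div]
        simp [add_comm]
    _ ≤ Real.exp ((Real.exp θ - 1) * ((∫ ω, W ω ∂P) / y)) := Real.add_one_le_exp _

lemma measureReal_le_sum_le_exp [IsProbabilityMeasure P] {ι : Type*} [Fintype ι] {V : ι → Ω → ℝ}
    (hV : ∀ i, Measurable (V i)) (hind : iIndepFun V P) {t : ℝ} (ht : 0 ≤ t)
    (hint : ∀ i, Integrable (fun ω => Real.exp (t * V i ω)) P) {a : ι → ℝ}
    (ha : ∀ i, mgf (V i) P t ≤ Real.exp (a i)) (r : ℝ) :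
    P.real {ω | r ≤ ∑ i, V i ω} ≤ Real.exp (-t * r + ∑ i, a i) := by
  have hsum := hind.integrable_exp_mul_sum hV (s := Finset.univ) fun i _ => hint i
  have h := measure_ge_le_exp_mul_mgf r ht hsum
  simp only [Finset.sum_apply] at h
  grw [h, hind.mgf_sum hV, Real.exp_add, Real.exp_sum,
    Finset.prod_le_prod (fun i _ => mgf_nonneg) fun i _ => ha i]

lemma measureReal_le_sum_le_exp_one_mul_rpow [IsProbabilityMeasure P] {ι : Type*} [Fintype ι]
    {W : ι → Ω → ℝ} (hW : ∀ i, Measurable (W i)) (hind : iIndepFun W P) {y c R : ℝ} (hy : 0 < y)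
    (hW0 : ∀ i ω, 0 ≤ W i ω) (hWy : ∀ i ω, W i ω ≤ y) (hc : 0 < c) (hR : 0 ≤ R)
    (hmean : ∑ i, ∫ ω, W i ω ∂P ≤ c * y) :
    P.real {ω | R * y ≤ ∑ i, W i ω} ≤ Real.exp 1 * c ^ R := by
  rcases lt_or_ge 1 c with hc1 | hc1
  · calc P.real {ω | R * y ≤ ∑ i, W i ω} ≤ 1 * 1 := by simp
      _ ≤ Real.exp 1 * c ^ R := by
        gcongr
        exacts [Real.one_le_exp zero_le_one, Real.one_le_rpow hc1.le hR]
  have hθ : Real.exp (-Real.log c) = c⁻¹ := by rw [Real.exp_neg, Real.exp_log hc]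
  have hθ0 : 0 ≤ -Real.log c / y := div_nonneg (neg_nonneg.2 (Real.log_nonpos hc.le hc1)) hy.le
  refine (measureReal_le_sum_le_exp hW hind hθ0 (fun i => integrable_exp_mul_of_abs_le (hW i)
    fun ω => (abs_of_nonneg (hW0 i ω)).trans_le (hWy i ω))
    (fun i => mgf_div_le_exp_of_nonneg_of_le _ hy (hW i) (hW0 i) (hWy i)) (R * y)).trans ?_
  rw [Real.rpow_def_of_pos hc, ← Real.exp_add, hθ, ← Finset.mul_sum, ← Finset.sum_div]
  have hfactor : 0 ≤ c⁻¹ - 1 := sub_nonneg.2 ((one_le_inv₀ hc).2 hc1)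
  have hmean' : (∑ i, ∫ ω, W i ω ∂P) / y ≤ c := (div_le_iff₀ hy).2 hmean
  refine Real.exp_le_exp.2 ?_
  calc -(-Real.log c / y) * (R * y) + (c⁻¹ - 1) * ((∑ i, ∫ ω, W i ω ∂P) / y)
      ≤ -(-Real.log c / y) * (R * y) + (c⁻¹ - 1) * c := by gcongr
    _ = Real.log c * R + (1 - c) := by field_simp
    _ ≤ 1 + Real.log c * R := by linarith

end BoundedSums

section MaximalInequality

variable {F ι : Type*} [NormedAddCommGroup F] [Fintype ι]

lemma exists_lt_norm_or_le_of_lt_abs_sum {φ : ι → F → ℝ} (hle : ∀ i z, |φ i z| ≤ ‖z‖) (z : ι → F)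
    {τ y R : ℝ} (h : (R + 1) * y < |∑ i, φ i (z i)|) :
    (∃ i, y < ‖z i‖) ∨ y ≤ |∑ i, {z | ‖z‖ ≤ τ}.indicator (φ i) (z i)| ∨
      R * y ≤ ∑ i, (Set.Ioc τ y).indicator id ‖z i‖ := by
  by_contra! hcon
  obtain ⟨hbig, hsmall, hmid⟩ := hcon
  have hdiff : ∀ i, |φ i (z i) - {z | ‖z‖ ≤ τ}.indicator (φ i) (z i)| ≤
      (Set.Ioc τ y).indicator id ‖z i‖ := by
    intro i
    rcases le_or_gt ‖z i‖ τ with hi | hi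
    · simp [Set.indicator, hi, hi.not_gt]
    · simpa [Set.indicator, hi, hi.not_ge, hbig i] using hle i (z i)
  have hsum : |∑ i, φ i (z i) - ∑ i, {z | ‖z‖ ≤ τ}.indicator (φ i) (z i)| ≤
      ∑ i, (Set.Ioc τ y).indicator id ‖z i‖ := by
    rw [← Finset.sum_sub_distrib]
    exact (Finset.abs_sum_le_sum_abs _ _).trans (Finset.sum_le_sum fun i _ => hdiff i)
  linarith [abs_sub_abs_le_abs_sub (∑ i, φ i (z i)) (∑ i, {z | ‖z‖ ≤ τ}.indicator (φ i) (z i))]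

variable {Ω : Type*} [MeasurableSpace Ω] {P : Measure Ω} [MeasurableSpace F] {α : ℝ}

lemma integral_comp_eq_zero_of_odd {Z : Ω → F} {g : F → ℝ}
    (hsymm : IdentDistrib (fun ω => -Z ω) Z P P) (hg : Measurable g) (hodd : g.Odd) :
    ∫ ω, g (Z ω) ∂P = 0 := by
  have h := (hsymm.comp hg).integral_eq
  simp only [Function.comp_def, hodd _, integral_neg] at h
  linarith

lemma integral_indicator_Ioc_le_of_tail_le [IsFiniteMeasure P] {τ y q : ℝ} (hα : α < 2)
    (hτ : 0 < τ) (hy : 0 < y) {Y : Ω → ℝ} (hY : Measurable Y) (hY0 : ∀ ω, 0 ≤ Y ω)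
    (htail : ∀ x, 0 < x → P.real {ω | x < Y ω} ≤ q * x ^ (-α)) :
    ∫ ω, (Set.Ioc τ y).indicator id (Y ω) ∂P ≤ 2 / (2 - α) * (q * y ^ (-α) * (y / τ)) * y := by
  have hpt : ∀ x : ℝ, (Set.Ioc τ y).indicator id x ≤ min x y ^ 2 / τ := by
    refine fun x => Set.indicator_apply_le' (fun hx => ?_) fun _ => by positivity
    rw [min_eq_left hx.2, le_div_iff₀ hτ, id, sq]
    exact mul_le_mul_of_nonneg_left hx.1.le (hτ.trans hx.1).le
  have hint : Integrable (fun ω => min (Y ω) y ^ 2 / τ) P := by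
    refine Integrable.of_mem_Icc 0 (y ^ 2 / τ)
      (((hY.min measurable_const).pow_const 2).div_const τ).aemeasurable
      (ae_of_all _ fun ω => ⟨by positivity, ?_⟩)
    have := hY0 ω
    gcongr
    exact min_le_right _ _
  calc ∫ ω, (Set.Ioc τ y).indicator id (Y ω) ∂P ≤ ∫ ω, min (Y ω) y ^ 2 / τ ∂P :=
        integral_mono_of_nonneg (ae_of_all _ fun ω => Set.indicator_nonneg
          (fun x hx => (hτ.trans hx.1).le) _) hint (ae_of_all _ fun ω => hpt _)
    _ ≤ 2 / (2 - α) * q * y ^ (2 - α) / τ := by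
        rw [integral_div]
        gcongr
        exact integral_min_sq_le_of_tail_le hα hy hY hY0 htail
    _ = 2 / (2 - α) * (q * y ^ (-α) * (y / τ)) * y := by
        rw [sub_eq_add_neg, Real.rpow_add hy, Real.rpow_two]
        ring

variable [IsProbabilityMeasure P] {κ : Type*} [Fintype κ] {q : ι → ℝ} {Z : ι → Ω → F}

lemma measureReal_le_sum_odd_le [OpensMeasurableSpace F] (hα : α < 2)
    (hZ : ∀ i, Measurable (Z i)) (hind : iIndepFun Z P)
    (hsymm : ∀ i, IdentDistrib (fun ω => -Z i ω) (Z i) P P)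
    (htail : ∀ i x, 0 < x → P.real {ω | x < ‖Z i ω‖} ≤ q i * x ^ (-α)) {g : ι → F → ℝ}
    (hg : ∀ i, Measurable (g i)) (hodd : ∀ i, (g i).Odd) {τ : ℝ} (hτ : 0 < τ)
    (hle : ∀ i z, |g i z| ≤ min ‖z‖ τ) (r : ℝ) :
    P.real {ω | r ≤ ∑ i, g i (Z i ω)} ≤
      Real.exp (-(r / τ) + 2 / (2 - α) * ((∑ i, q i) * τ ^ (-α))) := by
  have hgτ : ∀ i ω, |g i (Z i ω)| ≤ τ := fun i ω => (hle i _).trans (min_le_right _ _)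
  have hvar : ∀ i, ∫ ω, g i (Z i ω) ^ 2 ∂P ≤ 2 / (2 - α) * q i * τ ^ (2 - α) := by
    intro i
    refine le_trans (integral_mono_of_nonneg (ae_of_all _ fun ω => sq_nonneg _) ?_
      (ae_of_all _ fun ω => ?_)) (integral_min_sq_le_of_tail_le hα hτ (hZ i).norm
        (fun ω => norm_nonneg _) (htail i))
    · refine Integrable.of_mem_Icc 0 (τ ^ 2) ((hZ i).norm.min measurable_const |>.pow_const 2
        |>.aemeasurable) (ae_of_all _ fun ω => ⟨sq_nonneg _, ?_⟩)
      exact pow_le_pow_left₀ (le_min (norm_nonneg _) hτ.le) (min_le_right _ _) 2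
    · exact (sq_abs _).symm.trans_le (pow_le_pow_left₀ (abs_nonneg _) (hle i _) 2)
  refine (measureReal_le_sum_le_exp (fun i => (hg i).comp (hZ i)) (hind.comp g hg)
    (inv_nonneg.2 hτ.le)
    (fun i => integrable_exp_mul_of_abs_le ((hg i).comp (hZ i)) (hgτ i))
    (fun i => mgf_inv_le_exp_of_abs_le hτ ((hg i).comp (hZ i)) (hgτ i)
      (integral_comp_eq_zero_of_odd (g := g i) (hsymm i) (hg i) (hodd i)) (hvar i)) r).trans_eq ?_
  rw [← Finset.sum_div, ← Finset.sum_mul, ← Finset.mul_sum, sub_eq_add_neg, Real.rpow_add hτ,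
    Real.rpow_two]
  field_simp

lemma measureReal_le_sum_indicator_Ioc_le {Y : ι → Ω → ℝ} (hα : α < 2)
    (hY : ∀ i, Measurable (Y i)) (hY0 : ∀ i ω, 0 ≤ Y i ω) (hind : iIndepFun Y P)
    (htail : ∀ i x, 0 < x → P.real {ω | x < Y i ω} ≤ q i * x ^ (-α))
    {τ y Q R : ℝ} (hτ : 0 < τ) (hy : 0 < y) (hR : 0 ≤ R) (hQ : 0 < Q)
    (hqQ : (∑ i, q i) * y ^ (-α) ≤ Q) :
    P.real {ω | R * y ≤ ∑ i, (Set.Ioc τ y).indicator id (Y i ω)} ≤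
      Real.exp 1 * (2 / (2 - α) * (Q * (y / τ))) ^ R := by
  have hα' : 0 < 2 - α := by linarith
  have hmeas : Measurable ((Set.Ioc τ y).indicator (id : ℝ → ℝ)) :=
    measurable_id.indicator measurableSet_Ioc
  refine measureReal_le_sum_le_exp_one_mul_rpow (fun i => hmeas.comp (hY i))
    (hind.comp (fun _ => (Set.Ioc τ y).indicator id) fun _ => hmeas) hy
    (fun i ω => Set.indicator_nonneg (fun x hx => (hτ.trans hx.1).le) _)
    (fun i ω => Set.indicator_apply_le' (fun hx => hx.2) fun _ => hy.le)
    (by positivity) hR ((Finset.sum_le_sum fun i _ =>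
      integral_indicator_Ioc_le_of_tail_le hα hτ hy (hY i) (hY0 i) (htail i)).trans ?_)
  rw [← Finset.sum_mul, ← Finset.mul_sum, ← Finset.sum_mul, ← Finset.sum_mul]
  gcongr

lemma measureReal_le_abs_sum_indicator_le [OpensMeasurableSpace F] (hα : α < 2)
    (hZ : ∀ i, Measurable (Z i)) (hind : iIndepFun Z P)
    (hsymm : ∀ i, IdentDistrib (fun ω => -Z i ω) (Z i) P P)
    (htail : ∀ i x, 0 < x → P.real {ω | x < ‖Z i ω‖} ≤ q i * x ^ (-α)) {φ : ι → F → ℝ}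
    (hφ : ∀ i, Measurable (φ i)) (hodd : ∀ i, (φ i).Odd) (hle : ∀ i z, |φ i z| ≤ ‖z‖)
    {τ : ℝ} (hτ : 0 < τ) (r : ℝ) :
    P.real {ω | r ≤ |∑ i, {z | ‖z‖ ≤ τ}.indicator (φ i) (Z i ω)|} ≤
      2 * Real.exp (-(r / τ) + 2 / (2 - α) * ((∑ i, q i) * τ ^ (-α))) := by
  have hset : MeasurableSet {z : F | ‖z‖ ≤ τ} := measurableSet_le measurable_norm measurable_const
  have hmeas : ∀ i, Measurable ({z | ‖z‖ ≤ τ}.indicator (φ i)) := fun i => (hφ i).indicator hset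
  have hbound : ∀ i z, |{z | ‖z‖ ≤ τ}.indicator (φ i) z| ≤ min ‖z‖ τ := by
    intro i z
    by_cases hz : ‖z‖ ≤ τ
    · simpa [Set.indicator, hz] using hle i z
    · simp [Set.indicator, hz, hτ.le]
  have hodd' : ∀ i, ({z | ‖z‖ ≤ τ}.indicator (φ i)).Odd := by
    intro i z
    by_cases hz : ‖z‖ ≤ τ <;> simp [Set.indicator, hz, hodd i z]
  have hpos := measureReal_le_sum_odd_le hα hZ hind hsymm htail hmeas hodd' hτ hbound r
  have hneg := measureReal_le_sum_odd_le hα hZ hind hsymm htail (fun i => (hmeas i).neg)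
    (fun i z => congrArg Neg.neg (hodd' i z)) hτ
    (fun i z => (abs_neg _).trans_le (hbound i z)) r
  simp only [Pi.neg_apply, Finset.sum_neg_distrib] at hneg
  simp only [le_abs, Set.ofPred_or]
  exact (measureReal_union_le _ _).trans (by linarith)

/-- The bound of the maximal inequality for `N` sums of common heavy-tailed jumps. At scale `y`,
its terms account for the jumps of size above `y`, at most `y / L`, and in between; `Q` bounds the
expected number of jumps above `y`, and `R * y` is the room left for the intermediate ones. -/
noncomputable def maximalBound (α N L R Q : ℝ) : ℝ :=
  Q + 2 * N * Real.exp (-L + 2 / (2 - α) * (Q * L ^ α)) +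
    Real.exp 1 * (2 / (2 - α) * (Q * L)) ^ R

theorem measureReal_exists_lt_abs_sum_le [OpensMeasurableSpace F] (hα : α < 2)
    (hZ : ∀ i, Measurable (Z i)) (hind : iIndepFun Z P)
    (hsymm : ∀ i, IdentDistrib (fun ω => -Z i ω) (Z i) P P)
    (htail : ∀ i x, 0 < x → P.real {ω | x < ‖Z i ω‖} ≤ q i * x ^ (-α)) {φ : κ → ι → F → ℝ}
    (hφ : ∀ k i, Measurable (φ k i)) (hodd : ∀ k i, (φ k i).Odd)
    (hle : ∀ k i z, |φ k i z| ≤ ‖z‖) {y L R Q : ℝ} (hy : 0 < y) (hL : 0 < L) (hR : 0 ≤ R)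
    (hQ : 0 < Q) (hqQ : (∑ i, q i) * y ^ (-α) ≤ Q) :
    P.real {ω | ∃ k, (R + 1) * y < |∑ i, φ k i (Z i ω)|} ≤
      maximalBound α (Fintype.card κ) L R Q := by
  have hα' : 0 < 2 - α := by linarith
  have hτ : 0 < y / L := by positivity
  have hyτ : y / (y / L) = L := by field_simp
  have hbig : P.real (⋃ i, {ω | y < ‖Z i ω‖}) ≤ Q := by
    grw [measureReal_iUnion_fintype_le, Finset.sum_le_sum fun i _ => htail i y hy,
      ← Finset.sum_mul, hqQ]
  have hsmall : P.real (⋃ k, {ω | y ≤ |∑ i, {z | ‖z‖ ≤ y / L}.indicator (φ k i) (Z i ω)|}) ≤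
      2 * Fintype.card κ * Real.exp (-L + 2 / (2 - α) * (Q * L ^ α)) := by
    have hτα : (y / L) ^ (-α) = y ^ (-α) * L ^ α := by
      rw [Real.div_rpow hy.le hL.le, Real.rpow_neg hL.le, div_inv_eq_mul]
    grw [measureReal_iUnion_fintype_le, Finset.sum_le_sum fun k _ =>
      measureReal_le_abs_sum_indicator_le hα hZ hind hsymm htail (hφ k) (hodd k) (hle k) hτ y,
      hyτ, hτα, ← mul_assoc (∑ i, q i), hqQ, Finset.sum_const, nsmul_eq_mul, Finset.card_univ]
    exact le_of_eq (by ring)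
  have hmid := measureReal_le_sum_indicator_Ioc_le hα (fun i => (hZ i).norm)
    (fun i ω => norm_nonneg _) (hind.comp (fun _ => norm) fun _ => measurable_norm) htail hτ hy hR
    hQ hqQ
  rw [hyτ] at hmid
  have hsub : {ω | ∃ k, (R + 1) * y < |∑ i, φ k i (Z i ω)|} ⊆
      ((⋃ i, {ω | y < ‖Z i ω‖}) ∪
        ⋃ k, {ω | y ≤ |∑ i, {z | ‖z‖ ≤ y / L}.indicator (φ k i) (Z i ω)|}) ∪
          {ω | R * y ≤ ∑ i, (Set.Ioc (y / L) y).indicator id ‖Z i ω‖} := by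
    rintro ω ⟨k, hk⟩
    have h := exists_lt_norm_or_le_of_lt_abs_sum (hle k) (fun i => Z i ω) (τ := y / L) hk
    simp only [Set.mem_union, Set.mem_iUnion, Set.mem_ofPred_eq, or_assoc]
    exact h.imp_right (Or.imp_left fun h => ⟨k, h⟩)
  grw [measureReal_mono hsub, measureReal_union_le, measureReal_union_le, hbig, hsmall, hmid]
  rfl

end MaximalInequality

section CharFunTail

lemma measureReal_lt_abs_inner_le_of_charFun {V : Type*} [NormedAddCommGroup V]
    [InnerProductSpace ℝ V] [MeasurableSpace V] [BorelSpace V] [SecondCountableTopology V]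
    {μ : Measure V} [IsProbabilityMeasure μ] {α σ r : ℝ} (hα : 0 ≤ α) (hσ : 0 ≤ σ)
    (hμ : ∀ z, charFun μ z = ((Real.exp (-(σ * ‖z‖ ^ α)) : ℝ) : ℂ)) (hr : 0 < r) (a : V) :
    μ.real {x | r < |inner ℝ a x|} ≤ 2 * σ * (2 * ‖a‖ / r) ^ α := by
  have hbound : ∀ t ∈ Set.uIoc (-2 * r⁻¹) (2 * r⁻¹),
      ‖1 - charFun μ (t • a)‖ ≤ σ * (2 * ‖a‖ / r) ^ α := by
    intro t ht
    have hr' : -2 * r⁻¹ ≤ 2 * r⁻¹ := by linarith [inv_pos.2 hr]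
    rw [Set.uIoc_of_le hr'] at ht
    have hta : ‖t • a‖ ≤ 2 * ‖a‖ / r := by
      rw [norm_smul, mul_div_right_comm, div_eq_mul_inv]
      gcongr
      exact abs_le.2 ⟨by linarith [ht.1], ht.2⟩
    have hexp : Real.exp (-(σ * ‖t • a‖ ^ α)) ≤ 1 :=
      Real.exp_le_one_iff.2 (neg_nonpos.2 (by positivity))
    rw [hμ, ← Complex.ofReal_one, ← Complex.ofReal_sub, Complex.norm_real, Real.norm_eq_abs,
      abs_of_nonneg (sub_nonneg.2 hexp)]
    calc 1 - Real.exp (-(σ * ‖t • a‖ ^ α)) ≤ σ * ‖t • a‖ ^ α := by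
          linarith [Real.add_one_le_exp (-(σ * ‖t • a‖ ^ α))]
      _ ≤ σ * (2 * ‖a‖ / r) ^ α := by gcongr
  calc μ.real {x | r < |inner ℝ a x|}
      ≤ 2⁻¹ * r * ‖∫ t in (-2 * r⁻¹)..(2 * r⁻¹), 1 - charFun μ (t • a)‖ :=
        measureReal_abs_inner_gt_le_integral_charFun hr
    _ ≤ 2⁻¹ * r * (σ * (2 * ‖a‖ / r) ^ α * |2 * r⁻¹ - -2 * r⁻¹|) := by
        gcongr
        exact intervalIntegral.norm_integral_le_of_norm_le_const hbound
    _ = 2 * σ * (2 * ‖a‖ / r) ^ α := by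
        rw [show 2 * r⁻¹ - -2 * r⁻¹ = 4 * r⁻¹ by ring, abs_of_pos (by positivity)]
        field_simp
        ring

lemma measureReal_lt_norm_le_of_charFun {μ : Measure ℂ} [IsProbabilityMeasure μ] {α σ r : ℝ}
    (hα : 0 ≤ α) (hσ : 0 ≤ σ)
    (hμ : ∀ z : ℂ, charFun μ z = ((Real.exp (-(σ * ‖z‖ ^ α)) : ℝ) : ℂ)) (hr : 0 < r) :
    μ.real {x | r < ‖x‖} ≤ 4 * 4 ^ α * σ * r ^ (-α) := by
  have hsub : {x : ℂ | r < ‖x‖} ⊆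
      {x | r / 2 < |inner ℝ (1 : ℂ) x|} ∪ {x | r / 2 < |inner ℝ Complex.I x|} := by
    intro x hx
    by_contra hcon
    simp only [Set.mem_union, Set.mem_ofPred_eq, not_or, not_lt, Complex.inner, map_one, mul_one,
      Complex.conj_I, mul_neg, Complex.neg_re, Complex.mul_I_re, neg_neg] at hcon hx
    linarith [Complex.norm_le_abs_re_add_abs_im x]
  have htail : ∀ a : ℂ, ‖a‖ = 1 →
      μ.real {x | r / 2 < |inner ℝ a x|} ≤ 2 * 4 ^ α * σ * r ^ (-α) := by
    intro a ha
    refine (measureReal_lt_abs_inner_le_of_charFun hα hσ hμ (half_pos hr) a).trans_eq ?_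
    rw [ha, show 2 * 1 / (r / 2) = 4 * r⁻¹ by field_simp; norm_num,
      Real.mul_rpow (by norm_num) (by positivity), Real.inv_rpow hr.le, Real.rpow_neg hr.le]
    ring
  grw [measureReal_mono hsub, measureReal_union_le, htail 1 (by simp), htail Complex.I (by simp)]
  exact le_of_eq (by ring)

end CharFunTail

lemma tendstoInMeasure_sub {Ω ι E : Type*} [MeasurableSpace Ω] {P : Measure Ω} {l : Filter ι}
    [SeminormedAddCommGroup E] {f f' : ι → Ω → E} {g g' : Ω → E}
    (h : TendstoInMeasure P f l g) (h' : TendstoInMeasure P f' l g') :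
    TendstoInMeasure P (fun n ω => f n ω - f' n ω) l (fun ω => g ω - g' ω) := by
  rw [tendstoInMeasure_iff_norm] at *
  intro ε hε
  have hadd := (h (ε / 2) (half_pos hε)).add (h' (ε / 2) (half_pos hε))
  rw [add_zero] at hadd
  refine tendsto_of_tendsto_of_tendsto_of_le_of_le tendsto_const_nhds hadd (fun n => zero_le)
    fun n => (measure_mono fun ω hω => ?_).trans (measure_union_le _ _)
  by_contra! hcon
  simp only [Set.mem_union, Set.mem_ofPred_eq, not_or, not_le] at hcon hω
  have hnorm := norm_sub_le (f n ω - g ω) (f' n ω - g' ω)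
  rw [sub_sub_sub_comm] at hnorm
  linarith

section NonzeroRange

variable {E F : Type*} [MeasurableSpace E]

open Classical in
/-- The nonzero values of a simple function, that is, those that contribute to its integral. -/
noncomputable def nonzeroRange [Zero F] (S : SimpleFunc E F) : Finset F := S.range.erase 0

lemma mem_nonzeroRange [Zero F] {S : SimpleFunc E F} {v : F} :
    v ∈ nonzeroRange S ↔ v ≠ 0 ∧ v ∈ S.range := by
  classical
  exact Finset.mem_erase

lemma measure_preimage_nonzeroRange_lt_top [Zero F] {m : Measure E} {S : SimpleFunc E F}
    (hS : S.FinMeasSupp m) {v : F} (hv : v ∈ nonzeroRange S) : m (S ⁻¹' {v}) < ∞ :=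
  hS.meas_preimage_singleton_ne_zero (mem_nonzeroRange.1 hv).1

lemma sum_nonzeroRange_norm_rpow_mul_measureReal [NormedAddCommGroup F] {m : Measure E} {α : ℝ}
    (hα : 0 < α) {S : SimpleFunc E F} (hS : S.FinMeasSupp m) :
    ∑ v ∈ nonzeroRange S, ‖v‖ ^ α * m.real (S ⁻¹' {v}) =
      (eLpNorm S (ENNReal.ofReal α) m).toReal ^ α := by
  have hfin : ∀ v ∈ nonzeroRange S, ‖v‖ₑ ^ α * m (S ⁻¹' {v}) ≠ ∞ := fun v hv =>
    ENNReal.mul_ne_top (ENNReal.rpow_ne_top_of_nonneg hα.le enorm_ne_top)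
      (measure_preimage_nonzeroRange_lt_top hS hv).ne
  have hsum : ∑ v ∈ nonzeroRange S, ‖v‖ₑ ^ α * m (S ⁻¹' {v}) =
      ∑ v ∈ S.range, ‖v‖ₑ ^ α * m (S ⁻¹' {v}) := by
    classical
    exact Finset.sum_erase S.range (by simp [hα])
  rw [eLpNorm_eq_eLpNorm' (by simpa using hα) ENNReal.ofReal_ne_top, ENNReal.toReal_ofReal hα.le,
    SimpleFunc.eLpNorm'_eq, ENNReal.toReal_rpow, ← ENNReal.rpow_mul, one_div_mul_cancel hα.ne',
    ENNReal.rpow_one, ← hsum, ENNReal.toReal_sum hfin]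
  refine Finset.sum_congr rfl fun v _ => ?_
  rw [ENNReal.toReal_mul, ← ENNReal.toReal_rpow, toReal_enorm, measureReal_def]

lemma simpleStableIntegral_eq_sum_nonzeroRange {Ω : Type*} (M : Set E → Ω → ℂ)
    (S : SimpleFunc E ℂ) (ω : Ω) :
    simpleStableIntegral M S ω = ∑ v ∈ nonzeroRange S, v * M (S ⁻¹' {v}) ω := by
  classical
  exact (Finset.sum_erase _ (zero_mul _)).symm

end NonzeroRange

namespace IsIsotropicStableRandomMeasure

variable {E Ω F : Type*} [MeasurableSpace E] [MeasurableSpace Ω] {α : ℝ} {m : Measure E}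
  {P : Measure Ω} {M : Set E → Ω → ℂ}

lemma empty_ae_eq (hM : IsIsotropicStableRandomMeasure α m P M) : ∀ᵐ ω ∂P, M ∅ ω = 0 := by
  have hsum := hM.sigma_additive (fun _ => ∅) (fun _ => MeasurableSet.empty) (by simp)
    (fun _ _ _ => disjoint_bot_left)
  filter_upwards [hsum] with ω hω
  have hdiff := ((tendsto_add_atTop_iff_nat 1).2 hω).sub hω
  simp only [Finset.sum_range_succ, add_sub_cancel_left, sub_self] at hdiff
  exact tendsto_nhds_unique tendsto_const_nhds hdiff

lemma union_ae_eq (hM : IsIsotropicStableRandomMeasure α m P M) {A B : Set E}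
    (hA : MeasurableSet A) (hB : MeasurableSet B) (hmA : m A < ∞) (hmB : m B < ∞)
    (hAB : Disjoint A B) : ∀ᵐ ω ∂P, M (A ∪ B) ω = M A ω + M B ω := by
  let C : ℕ → Set E
    | 0 => A
    | 1 => B
    | _ + 2 => ∅
  have hC : ⋃ n, C n = A ∪ B := by
    rw [← Set.union_iUnion_nat_succ, ← Set.union_iUnion_nat_succ (u := fun n => C (n + 1))]
    simp [C]
  have hsum := hM.sigma_additive C
    (fun n => match n with
      | 0 => hA
      | 1 => hB
      | _ + 2 => MeasurableSet.empty)
    (by rw [hC]; exact measure_union_lt_top hmA hmB)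
    (fun i j hij => match i, j, hij with
      | 0, 0, h => (h rfl).elim
      | 0, 1, _ => hAB
      | 1, 0, _ => hAB.symm
      | 1, 1, h => (h rfl).elim
      | _, _ + 2, _ => disjoint_bot_right
      | _ + 2, _, _ => disjoint_bot_left)
  filter_upwards [hsum, hM.empty_ae_eq] with ω hω hempty
  rw [hC] at hω
  refine tendsto_nhds_unique ((tendsto_add_atTop_iff_nat 2).2 hω) ?_
  simp [Finset.sum_range_succ', C, hempty, add_comm]

lemma biUnion_ae_eq (hM : IsIsotropicStableRandomMeasure α m P M) {ι : Type*} (s : Finset ι)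
    {A : ι → Set E} (hA : ∀ i ∈ s, MeasurableSet (A i)) (hmA : ∀ i ∈ s, m (A i) < ∞)
    (hdisj : Pairwise (Function.onFun Disjoint A)) :
    ∀ᵐ ω ∂P, M (⋃ i ∈ s, A i) ω = ∑ i ∈ s, M (A i) ω := by
  classical
  induction s using Finset.induction_on with
  | empty => simpa using hM.empty_ae_eq
  | insert a s ha ih =>
    rw [Finset.forall_mem_insert] at hA hmA
    have hunion := hM.union_ae_eq hA.1 (Finset.measurableSet_biUnion s hA.2) hmA.1
      (measure_biUnion_lt_top s.finite_toSet hmA.2)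
      (Set.disjoint_iUnion₂_right.2 fun i hi => hdisj (ne_of_mem_of_not_mem hi ha).symm)
    filter_upwards [ih hA.2 hmA.2, hunion] with ω hs hω
    rw [Finset.set_biUnion_insert, hω, hs, Finset.sum_insert ha]

lemma const_mul_preimage_map_ae_eq (hM : IsIsotropicStableRandomMeasure α m P M) [Zero F]
    {S : SimpleFunc E F} (hS : S.FinMeasSupp m) {G : F → ℂ} (hG : G 0 = 0) (c : ℂ) :
    ∀ᵐ ω ∂P, c * M (S.map G ⁻¹' {c}) ω =
      ∑ v ∈ nonzeroRange S with G v = c, G v * M (S ⁻¹' {v}) ω := by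
  rcases eq_or_ne c 0 with rfl | hc
  · refine ae_of_all _ fun ω => ?_
    rw [zero_mul, Finset.sum_eq_zero fun v hv => ?_]
    rw [(Finset.mem_filter.1 hv).2, zero_mul]
  have hpreimage : S.map G ⁻¹' {c} = ⋃ v ∈ (nonzeroRange S).filter (G · = c), S ⁻¹' {v} := by
    ext x
    have hx : G (S x) = c → S x ≠ 0 := fun h h0 => hc (by rw [← h, h0, hG])
    simpa [mem_nonzeroRange] using hx
  have hadd := hM.biUnion_ae_eq ((nonzeroRange S).filter (G · = c)) (A := fun v => S ⁻¹' {v})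
    (fun v _ => S.measurableSet_fiber v)
    (fun v hv => measure_preimage_nonzeroRange_lt_top hS (Finset.mem_filter.1 hv).1)
    (pairwise_disjoint_fiber S)
  filter_upwards [hadd] with ω hω
  rw [hpreimage, hω, Finset.mul_sum]
  refine Finset.sum_congr rfl fun v hv => ?_
  rw [(Finset.mem_filter.1 hv).2]

lemma simpleStableIntegral_map_ae_eq (hM : IsIsotropicStableRandomMeasure α m P M) [Zero F]
    {S : SimpleFunc E F} (hS : S.FinMeasSupp m) {G : F → ℂ} (hG : G 0 = 0) :
    ∀ᵐ ω ∂P, simpleStableIntegral M (S.map G) ω =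
      ∑ v ∈ nonzeroRange S, G v * M (S ⁻¹' {v}) ω := by
  have hvalues := (Finset.eventually_all (S.map G).range).2 fun c _ =>
    hM.const_mul_preimage_map_ae_eq hS hG c
  filter_upwards [hvalues] with ω hω
  rw [simpleStableIntegral, Finset.sum_congr rfl hω]
  refine Finset.sum_fiberwise_of_maps_to (fun v hv => ?_) _
  rw [SimpleFunc.range_map]
  exact Finset.mem_image_of_mem _ (mem_nonzeroRange.1 hv).2

lemma simpleStableIntegral_sub_ae_eq (hM : IsIsotropicStableRandomMeasure α m P M)
    {s s' : SimpleFunc E ℂ} (hs : s.FinMeasSupp m) (hs' : s'.FinMeasSupp m) :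
    ∀ᵐ ω ∂P, simpleStableIntegral M (s - s') ω =
      simpleStableIntegral M s ω - simpleStableIntegral M s' ω := by
  have hfst := hM.simpleStableIntegral_map_ae_eq (hs.pair hs') (G := Prod.fst) rfl
  have hsnd := hM.simpleStableIntegral_map_ae_eq (hs.pair hs') (G := Prod.snd) rfl
  have hsub := hM.simpleStableIntegral_map_ae_eq (hs.pair hs') (G := fun p => p.1 - p.2) (by simp)
  rw [SimpleFunc.map_fst_pair] at hfst
  rw [SimpleFunc.map_snd_pair] at hsnd
  rw [show (s.pair s').map (fun p => p.1 - p.2) = s - s' from rfl] at hsub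
  filter_upwards [hfst, hsnd, hsub] with ω hfst hsnd hsub
  simp only [hfst, hsnd, hsub, ← Finset.sum_sub_distrib, sub_mul]

lemma charFun_const_mul (hM : IsIsotropicStableRandomMeasure α m P M) {A : Set E}
    (hA : MeasurableSet A) (hmA : m A < ∞) (a z : ℂ) :
    charFun (P.map fun ω => a * M A ω) z =
      ((Real.exp (-(‖a‖ ^ α * m.real A * ‖z‖ ^ α)) : ℝ) : ℂ) := by
  have hmeas := hM.measurable A hA hmA
  have hadjoint : charFun (P.map fun ω => a * M A ω) z =
      charFun (P.map (M A)) (starRingEnd ℂ a * z) := by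
    rw [charFun_apply, charFun_apply, integral_map (by fun_prop) (by fun_prop),
      integral_map (by fun_prop) (by fun_prop)]
    simp only [Complex.inner, map_mul, mul_assoc, mul_left_comm]
  rw [hadjoint, hM.charFun_eq A hA hmA, norm_mul, RCLike.norm_conj,
    Real.mul_rpow (norm_nonneg _) (norm_nonneg _), measureReal_def]
  ring_nf

lemma measureReal_lt_norm_const_mul_le [IsProbabilityMeasure P]
    (hM : IsIsotropicStableRandomMeasure α m P M) (hα : 0 ≤ α) {A : Set E} (hA : MeasurableSet A)
    (hmA : m A < ∞) (a : ℂ) {r : ℝ} (hr : 0 < r) :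
    P.real {ω | r < ‖a * M A ω‖} ≤ 4 * 4 ^ α * (‖a‖ ^ α * m.real A) * r ^ (-α) := by
  have hmeas : Measurable fun ω => a * M A ω := (hM.measurable A hA hmA).const_mul a
  have := Measure.isProbabilityMeasure_map hmeas.aemeasurable (μ := P)
  have htail := measureReal_lt_norm_le_of_charFun hα (by positivity) (hM.charFun_const_mul hA hmA a)
    hr
  rwa [map_measureReal_apply hmeas (measurableSet_lt measurable_const measurable_norm)] at htail

lemma identDistrib_neg_const_mul [IsProbabilityMeasure P]
    (hM : IsIsotropicStableRandomMeasure α m P M) {A : Set E} (hA : MeasurableSet A)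
    (hmA : m A < ∞) (a : ℂ) :
    IdentDistrib (fun ω => -(a * M A ω)) (fun ω => a * M A ω) P P := by
  have hmeas := hM.measurable A hA hmA
  have hneg : AEMeasurable (fun ω => -(a * M A ω)) P := by fun_prop
  have hpos : AEMeasurable (fun ω => a * M A ω) P := by fun_prop
  have := Measure.isProbabilityMeasure_map hneg
  have := Measure.isProbabilityMeasure_map hpos
  refine ⟨hneg, hpos, Measure.ext_of_charFun (funext fun z => ?_)⟩
  simp_rw [← neg_mul]
  rw [hM.charFun_const_mul hA hmA, hM.charFun_const_mul hA hmA, norm_neg]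

lemma iIndepFun_of_finite (hM : IsIsotropicStableRandomMeasure α m P M) {ι : Type*} [Finite ι]
    {A : ι → Set E} (hA : ∀ i, MeasurableSet (A i)) (hmA : ∀ i, m (A i) < ∞)
    (hdisj : Pairwise (Function.onFun Disjoint A)) : iIndepFun (fun i => M (A i)) P := by
  have e := Finite.equivFin ι
  have h := hM.indep _ (fun i => A (e.symm i)) (fun i => hA _) (fun i => hmA _)
    (fun i j hij => hdisj (e.symm.injective.ne hij))
  simpa using h.precomp e.injective

lemma iIndepFun_preimage_nonzeroRange (hM : IsIsotropicStableRandomMeasure α m P M) [Zero F]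
    {S : SimpleFunc E F} (hS : S.FinMeasSupp m) :
    iIndepFun (fun v : nonzeroRange S => M (S ⁻¹' {v.1})) P :=
  hM.iIndepFun_of_finite (fun _ => S.measurableSet_fiber _)
    (fun v => measure_preimage_nonzeroRange_lt_top hS v.2)
    ((pairwise_disjoint_fiber S).comp_of_injective Subtype.val_injective)

lemma measurable_preimage_nonzeroRange (hM : IsIsotropicStableRandomMeasure α m P M) [Zero F]
    {S : SimpleFunc E F} (hS : S.FinMeasSupp m) {v : F} (hv : v ∈ nonzeroRange S) :
    Measurable (M (S ⁻¹' {v})) :=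
  hM.measurable _ (S.measurableSet_fiber v) (measure_preimage_nonzeroRange_lt_top hS hv)

lemma measurable_simpleStableIntegral (hM : IsIsotropicStableRandomMeasure α m P M)
    {S : SimpleFunc E ℂ} (hS : S.FinMeasSupp m) : Measurable (simpleStableIntegral M S) := by
  simp_rw [funext (simpleStableIntegral_eq_sum_nonzeroRange M S)]
  exact Finset.measurable_sum _ fun v hv => (hM.measurable_preimage_nonzeroRange hS hv).const_mul v

lemma charFun_simpleStableIntegral (hM : IsIsotropicStableRandomMeasure α m P M) (hα : 0 < α)
    {S : SimpleFunc E ℂ} (hS : S.FinMeasSupp m) (z : ℂ) :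
    charFun (P.map (simpleStableIntegral M S)) z =
      ((Real.exp (-((eLpNorm S (ENNReal.ofReal α) m).toReal ^ α * ‖z‖ ^ α)) : ℝ) : ℂ) := by
  have hind : iIndepFun (fun (v : nonzeroRange S) ω => v.1 * M (S ⁻¹' {v.1}) ω) P :=
    (hM.iIndepFun_preimage_nonzeroRange hS).comp (fun v z => v.1 * z)
      fun v => measurable_const_mul _
  have hmeas : ∀ v : nonzeroRange S, AEMeasurable (fun ω => v.1 * M (S ⁻¹' {v.1}) ω) P := fun v =>
    ((hM.measurable_preimage_nonzeroRange hS v.2).const_mul _).aemeasurable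
  have hsum : simpleStableIntegral M S =
      fun ω => ∑ v : nonzeroRange S, v.1 * M (S ⁻¹' {v.1}) ω := by
    ext ω
    rw [simpleStableIntegral_eq_sum_nonzeroRange,
      Finset.sum_coe_sort _ fun v => v * M (S ⁻¹' {v}) ω]
  rw [hsum, hind.charFun_map_fun_sum_eq_prod hmeas, Finset.prod_apply]
  simp_rw [fun v : nonzeroRange S => hM.charFun_const_mul (S.measurableSet_fiber v.1)
    (measure_preimage_nonzeroRange_lt_top hS v.2) v.1 z]
  rw [← Complex.ofReal_prod, ← Real.exp_sum, Finset.sum_neg_distrib, ← Finset.sum_mul,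
    Finset.sum_coe_sort _ fun v => ‖v‖ ^ α * m.real (S ⁻¹' {v}),
    sum_nonzeroRange_norm_rpow_mul_measureReal hα hS]

lemma measureReal_lt_norm_simpleStableIntegral_le [IsProbabilityMeasure P]
    (hM : IsIsotropicStableRandomMeasure α m P M) (hα : 0 < α) {S : SimpleFunc E ℂ}
    (hS : S.FinMeasSupp m) {r : ℝ} (hr : 0 < r) :
    P.real {ω | r < ‖simpleStableIntegral M S ω‖} ≤
      4 * 4 ^ α * (eLpNorm S (ENNReal.ofReal α) m).toReal ^ α * r ^ (-α) := by
  have hmeas := hM.measurable_simpleStableIntegral hS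
  have := Measure.isProbabilityMeasure_map hmeas.aemeasurable (μ := P)
  have htail := measureReal_lt_norm_le_of_charFun hα.le (by positivity)
    (hM.charFun_simpleStableIntegral hα hS) hr
  rwa [map_measureReal_apply hmeas (measurableSet_lt measurable_const measurable_norm)] at htail

lemma tendstoInMeasure_simpleStableIntegral_zero [IsProbabilityMeasure P] {ι : Type*}
    {l : Filter ι} (hM : IsIsotropicStableRandomMeasure α m P M) (hα : 0 < α)
    {S : ι → SimpleFunc E ℂ} (hS : ∀ n, (S n).FinMeasSupp m)
    (h : Tendsto (fun n => eLpNorm (S n) (ENNReal.ofReal α) m) l (𝓝 0)) :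
    TendstoInMeasure P (fun n => simpleStableIntegral M (S n)) l (fun _ => 0) := by
  rw [tendstoInMeasure_iff_measureReal_norm]
  intro ε hε
  have hbound : Tendsto (fun n => 4 * 4 ^ α * (eLpNorm (S n) (ENNReal.ofReal α) m).toReal ^ α *
      (ε / 2) ^ (-α)) l (𝓝 0) := by
    have hnorm := (ENNReal.tendsto_toReal ENNReal.zero_ne_top).comp h
    have hrpow := (Real.continuousAt_rpow_const _ α (Or.inr hα.le)).tendsto.comp hnorm
    simpa [Function.comp_def, hα.ne'] using (hrpow.const_mul (4 * 4 ^ α)).mul_const ((ε / 2) ^ (-α))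
  refine squeeze_zero (fun _ => measureReal_nonneg) (fun n => ?_) hbound
  refine le_trans (measureReal_mono fun ω hω => ?_)
    (hM.measureReal_lt_norm_simpleStableIntegral_le hα (hS n) (half_pos hε))
  rw [Set.mem_ofPred_eq, sub_zero] at hω
  exact (half_lt_self hε).trans_le hω

lemma tendstoInMeasure_simpleStableIntegral_sub [IsProbabilityMeasure P] {ι : Type*}
    {l : Filter ι} (hM : IsIsotropicStableRandomMeasure α m P M) (hα : 0 < α)
    {s s' : ι → SimpleFunc E ℂ} (hs : ∀ n, (s n).FinMeasSupp m) (hs' : ∀ n, (s' n).FinMeasSupp m)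
    (h : Tendsto (fun n => eLpNorm (s n - s' n : SimpleFunc E ℂ) (ENNReal.ofReal α) m) l (𝓝 0)) :
    TendstoInMeasure P (fun n ω => simpleStableIntegral M (s n) ω - simpleStableIntegral M (s' n) ω)
      l (fun _ => 0) :=
  (hM.tendstoInMeasure_simpleStableIntegral_zero hα
    (fun n => (hs n).map₂ (hs' n) (op := fun a b => a - b) (sub_zero 0)) h).congr_left
    fun n => hM.simpleStableIntegral_sub_ae_eq (hs n) (hs' n)

end IsIsotropicStableRandomMeasure

section StableIntegral

variable {E Ω : Type*} [MeasurableSpace E] [MeasurableSpace Ω] {α : ℝ} {m : Measure E}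
  {P : Measure Ω} {M : Set E → Ω → ℂ}

lemma tendsto_eLpNorm_sub_zero {ι F : Type*} [NormedAddCommGroup F] {l : Filter ι} {p : ℝ≥0∞}
    {f g : ι → E → F} (hf : ∀ n, AEStronglyMeasurable (f n) m)
    (hg : ∀ n, AEStronglyMeasurable (g n) m) (hf0 : Tendsto (fun n => eLpNorm (f n) p m) l (𝓝 0))
    (hg0 : Tendsto (fun n => eLpNorm (g n) p m) l (𝓝 0)) :
    Tendsto (fun n => eLpNorm (f n - g n) p m) l (𝓝 0) := by
  have hsum := ENNReal.Tendsto.const_mul (hf0.add hg0) (Or.inr (ENNReal.LpAddConst_lt_top p).ne)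
  rw [add_zero, mul_zero] at hsum
  exact tendsto_of_tendsto_of_tendsto_of_le_of_le tendsto_const_nhds hsum (fun _ => zero_le)
    fun n => eLpNorm_sub_le' (hf n) (hg n) p

namespace IsStableIntegral

lemma tendstoInMeasure [IsProbabilityMeasure P] (hα : 0 < α)
    (hM : IsIsotropicStableRandomMeasure α m P M) {f : E → ℂ} (hf : AEStronglyMeasurable f m)
    {J : Ω → ℂ} (hJ : IsStableIntegral α m P M f J) {S : ℕ → SimpleFunc E ℂ}
    (hS : ∀ n, (S n).FinMeasSupp m)
    (hSf : Tendsto (fun n => eLpNorm (fun x => S n x - f x) (ENNReal.ofReal α) m) atTop (𝓝 0)) :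
    TendstoInMeasure P (fun n => simpleStableIntegral M (S n)) atTop J := by
  obtain ⟨s, hs, hsf, hsJ⟩ := hJ
  have hdiff := tendsto_eLpNorm_sub_zero (fun n => (s n).aestronglyMeasurable.sub hf)
    (fun n => (S n).aestronglyMeasurable.sub hf) hsf hSf
  simp only [Pi.sub_def, sub_sub_sub_cancel_right] at hdiff
  simpa using tendstoInMeasure_sub hsJ (hM.tendstoInMeasure_simpleStableIntegral_sub hα hs hS hdiff)

lemma sub (hM : IsIsotropicStableRandomMeasure α m P M) {f f' : E → ℂ}
    (hf : AEStronglyMeasurable f m) (hf' : AEStronglyMeasurable f' m) {J J' : Ω → ℂ}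
    (hJ : IsStableIntegral α m P M f J) (hJ' : IsStableIntegral α m P M f' J') :
    IsStableIntegral α m P M (fun x => f x - f' x) (fun ω => J ω - J' ω) := by
  obtain ⟨s, hs, hsf, hsJ⟩ := hJ
  obtain ⟨s', hs', hsf', hsJ'⟩ := hJ'
  refine ⟨fun n => s n - s' n, fun n => (hs n).map₂ (hs' n) (op := fun a b => a - b) (sub_zero 0),
    ?_, (tendstoInMeasure_sub hsJ hsJ').congr_left fun n => ?_⟩
  · have hdiff := tendsto_eLpNorm_sub_zero (fun n => (s n).aestronglyMeasurable.sub hf)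
      (fun n => (s' n).aestronglyMeasurable.sub hf') hsf hsf'
    simpa only [Pi.sub_def, SimpleFunc.coe_sub, sub_sub_sub_comm] using hdiff
  · filter_upwards [hM.simpleStableIntegral_sub_ae_eq (hs n) (hs' n)] with ω hω
    exact hω.symm

end IsStableIntegral

lemma exists_simpleFunc_tendsto_eLpNorm {F : Type*} [NormedAddCommGroup F]
    [SecondCountableTopology F] [MeasurableSpace F] [BorelSpace F] {p : ℝ≥0∞} (hp : p ≠ 0)
    (hp' : p ≠ ∞) {f : E → F} (hfm : Measurable f) (hf : MemLp f p m) :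
    ∃ S : ℕ → SimpleFunc E F, (∀ n, (S n).FinMeasSupp m) ∧ (∀ n x, ‖S n x‖ ≤ 2 * ‖f x‖) ∧
      Tendsto (fun n => eLpNorm (fun x => S n x - f x) p m) atTop (𝓝 0) := by
  have h0 : (0 : F) ∈ Set.range f ∪ {0} := by simp
  refine ⟨SimpleFunc.approxOn f hfm (Set.range f ∪ {0}) 0 h0, fun n => ?_, fun n x => ?_,
    SimpleFunc.tendsto_approxOn_range_Lp_eLpNorm hp' hfm hf.2⟩
  · exact (SimpleFunc.memLp_iff_finMeasSupp hp hp').1 (SimpleFunc.memLp_approxOn_range hfm hf n)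
  · linarith [SimpleFunc.norm_approxOn_zero_le hfm h0 x n]

variable {κ : Type*} [Fintype κ]

namespace IsIsotropicStableRandomMeasure

lemma ae_forall_re_simpleStableIntegral_map_eq (hM : IsIsotropicStableRandomMeasure α m P M)
    {S : SimpleFunc E (κ → ℂ)} (hS : S.FinMeasSupp m) :
    ∀ᵐ ω ∂P, ∀ k, (simpleStableIntegral M (S.map (· k)) ω).re =
      ∑ v : nonzeroRange S, (v.1 k / (‖v.1‖ : ℂ) * ((‖v.1‖ : ℂ) * M (S ⁻¹' {v.1}) ω)).re := by
  refine ae_all_iff.2 fun k => ?_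
  filter_upwards [hM.simpleStableIntegral_map_ae_eq hS (G := (· k)) rfl] with ω hω
  rw [hω, Complex.re_sum, ← Finset.sum_coe_sort]
  refine Finset.sum_congr rfl fun v _ => congrArg Complex.re ?_
  have hv : (‖v.1‖ : ℂ) ≠ 0 := by simpa using (mem_nonzeroRange.1 v.2).1
  rw [← mul_assoc, div_mul_cancel₀ _ hv]

variable [IsProbabilityMeasure P]

lemma measureReal_exists_lt_abs_re_simpleStableIntegral_le
    (hM : IsIsotropicStableRandomMeasure α m P M) (hα : α ∈ Set.Ioo 0 2)
    {S : SimpleFunc E (κ → ℂ)} (hS : S.FinMeasSupp m) {y L R Q : ℝ} (hy : 0 < y) (hL : 0 < L)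
    (hR : 0 ≤ R) (hQ : 0 < Q)
    (hSQ : 4 * 4 ^ α * (eLpNorm S (ENNReal.ofReal α) m).toReal ^ α * y ^ (-α) ≤ Q) :
    P.real {ω | ∃ k, (R + 1) * y < |(simpleStableIntegral M (S.map (· k)) ω).re|} ≤
      maximalBound α (Fintype.card κ) L R Q := by
  let Z : nonzeroRange S → Ω → ℂ := fun v ω => (‖v.1‖ : ℂ) * M (S ⁻¹' {v.1}) ω
  let φ : κ → nonzeroRange S → ℂ → ℝ := fun k v z => (v.1 k / (‖v.1‖ : ℂ) * z).re
  have hfin : ∀ v : nonzeroRange S, m (S ⁻¹' {v.1}) < ∞ := fun v =>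
    measure_preimage_nonzeroRange_lt_top hS v.2
  have hφ_le : ∀ k v z, |φ k v z| ≤ ‖z‖ := fun k v z => by
    refine (Complex.abs_re_le_norm _).trans ?_
    rw [norm_mul, norm_div, Complex.norm_real, norm_norm]
    exact mul_le_of_le_one_left (norm_nonneg z)
      (div_le_one_of_le₀ (norm_le_pi_norm _ k) (norm_nonneg _))
  have htail : ∀ v x, 0 < x → P.real {ω | x < ‖Z v ω‖} ≤
      4 * 4 ^ α * (‖v.1‖ ^ α * m.real (S ⁻¹' {v.1})) * x ^ (-α) := fun v x hx => by
    simpa only [Complex.norm_real, norm_norm] using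
      hM.measureReal_lt_norm_const_mul_le hα.1.le (S.measurableSet_fiber v.1) (hfin v)
        (‖v.1‖ : ℂ) hx
  have hjumps : (∑ v : nonzeroRange S, 4 * 4 ^ α * (‖v.1‖ ^ α * m.real (S ⁻¹' {v.1}))) *
      y ^ (-α) ≤ Q := by
    rwa [← Finset.mul_sum, Finset.sum_coe_sort _ fun v => ‖v‖ ^ α * m.real (S ⁻¹' {v}),
      sum_nonzeroRange_norm_rpow_mul_measureReal hα.1 hS]
  refine le_of_eq_of_le (measureReal_congr (eventuallyEq_set.2 ?_))
    (measureReal_exists_lt_abs_sum_le hα.2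
      (fun v => (hM.measurable_preimage_nonzeroRange hS v.2).const_mul _)
      ((hM.iIndepFun_preimage_nonzeroRange hS).comp (fun v z => (‖v.1‖ : ℂ) * z)
        fun v => measurable_const_mul _)
      (fun v => hM.identDistrib_neg_const_mul (S.measurableSet_fiber v.1) (hfin v) _) htail
      (φ := φ) (fun k v => by fun_prop) (fun k v z => by simp only [φ, mul_neg, Complex.neg_re])
      hφ_le hy hL hR hQ hjumps)
  filter_upwards [hM.ae_forall_re_simpleStableIntegral_map_eq hS] with ω hω
  simp only [hω, φ]

theorem measureReal_exists_lt_abs_re_le (hM : IsIsotropicStableRandomMeasure α m P M)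
    (hα : α ∈ Set.Ioo 0 2) {f : κ → E → ℂ} (hf : ∀ k, Measurable (f k)) {J : κ → Ω → ℂ}
    (hJ : ∀ k, IsStableIntegral α m P M (f k) (J k)) {a : ℝ} (ha : 0 ≤ a)
    (hfa : eLpNorm (fun x k => f k x) (ENNReal.ofReal α) m ≤ ENNReal.ofReal a)
    {y L R Q : ℝ} (hy : 0 < y) (hL : 0 < L) (hR : 0 ≤ R) (hQ : 0 < Q)
    (haQ : 4 * 4 ^ α * (2 * a) ^ α * y ^ (-α) ≤ Q) :
    P.real {ω | ∃ k, (R + 2) * y < |(J k ω).re|} ≤ maximalBound α (Fintype.card κ) L R Q := by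
  obtain ⟨S, hS, hSf, hlim⟩ := exists_simpleFunc_tendsto_eLpNorm (by simpa using hα.1)
    ENNReal.ofReal_ne_top (measurable_pi_lambda _ hf)
    ⟨(measurable_pi_lambda _ hf).aestronglyMeasurable, hfa.trans_lt ENNReal.ofReal_lt_top⟩
  have hSa : ∀ n, (eLpNorm (S n) (ENNReal.ofReal α) m).toReal ≤ 2 * a := fun n => by
    refine ENNReal.toReal_le_of_le_ofReal (by positivity) ?_
    grw [eLpNorm_le_mul_eLpNorm_of_ae_le_mul (ae_of_all _ (hSf n)), hfa,
      ← ENNReal.ofReal_mul zero_le_two]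
  have hconv : ∀ k, TendstoInMeasure P (fun n => simpleStableIntegral M ((S n).map (· k))) atTop
      (J k) := fun k =>
    (hJ k).tendstoInMeasure hα.1 hM (hf k).aestronglyMeasurable (fun n => (hS n).map rfl)
      (tendsto_of_tendsto_of_tendsto_of_le_of_le tendsto_const_nhds hlim (fun _ => zero_le)
        fun n => eLpNorm_mono fun x => norm_le_pi_norm (fun k => S n x k - f k x) k)
  have herror : Tendsto (fun n => maximalBound α (Fintype.card κ) L R Q +
      ∑ k, P.real {ω | y ≤ ‖simpleStableIntegral M ((S n).map (· k)) ω - J k ω‖}) atTop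
      (𝓝 (maximalBound α (Fintype.card κ) L R Q + ∑ _k : κ, 0)) :=
    tendsto_const_nhds.add (tendsto_finsetSum _ fun k _ =>
      tendstoInMeasure_iff_measureReal_norm.1 (hconv k) y hy)
  rw [Finset.sum_const_zero, add_zero] at herror
  refine ge_of_tendsto' herror fun n => ?_
  grw [← hM.measureReal_exists_lt_abs_re_simpleStableIntegral_le hα (hS n) hy hL hR hQ
    (le_trans (by grw [hSa n]; exact hα.1.le) haQ), ← measureReal_iUnion_fintype_le,
    ← measureReal_union_le]
  refine measureReal_mono ?_
  rintro ω ⟨k, hk⟩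
  by_contra hcon
  simp only [Set.mem_union, Set.mem_iUnion, Set.mem_ofPred_eq, not_or, not_exists, not_le,
    not_lt] at hcon
  have hclose := (Complex.abs_re_le_norm _).trans_lt (hcon.2 k)
  rw [Complex.sub_re, abs_sub_comm] at hclose
  linarith [hcon.1 k, abs_sub_abs_le_abs_sub (J k ω).re
    (simpleStableIntegral M ((S n).map (· k)) ω).re]

end IsIsotropicStableRandomMeasure

end StableIntegral

section Kernel

lemma norm_exp_I_mul_ofReal_sub_exp_le (u v : ℝ) :
    ‖Complex.exp (Complex.I * u) - Complex.exp (Complex.I * v)‖ ≤ min 2 |u - v| := by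
  refine le_min ?_ ?_
  · grw [norm_sub_le, Complex.norm_exp_I_mul_ofReal, Complex.norm_exp_I_mul_ofReal,
      one_add_one_eq_two]
  · have hfactor : Complex.exp (Complex.I * u) - Complex.exp (Complex.I * v) =
        Complex.exp (Complex.I * v) * (Complex.exp (Complex.I * (u - v : ℝ)) - 1) := by
      rw [mul_sub, mul_one, ← Complex.exp_add]
      push_cast
      ring_nf
    rw [hfactor, norm_mul, Complex.norm_exp_I_mul_ofReal, one_mul]
    exact Real.norm_exp_I_mul_ofReal_sub_one_le

lemma eLpNorm_comp_mul_left {F : Type*} [NormedAddCommGroup F] {f : ℝ → F}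
    (hf : AEStronglyMeasurable f) {p : ℝ≥0∞} (hp : p ≠ ∞) {a : ℝ} (ha : 0 < a) :
    eLpNorm (fun x => f (a * x)) p = ENNReal.ofReal (a ^ (-(1 / p.toReal))) * eLpNorm f p := by
  have hmap := Real.map_volume_mul_left ha.ne'
  rw [← Function.comp_def f, ← eLpNorm_map_measure (by rw [hmap]; exact hf.smul_measure _)
    (by fun_prop), hmap, eLpNorm_smul_measure_of_ne_top hp, smul_eq_mul,
    abs_of_pos (inv_pos.2 ha), ENNReal.ofReal_rpow_of_pos (inv_pos.2 ha), Real.inv_rpow ha.le,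
    Real.rpow_neg ha.le, one_div, one_div, ENNReal.toReal_inv]

lemma integrableOn_Ioi_min_rpow_mul_rpow {c a b : ℝ} (hc : 0 ≤ c) (ha : 0 ≤ a) (hb : 1 < b)
    (hba : b < a + 1) :
    IntegrableOn (fun x : ℝ => min c x ^ a * x ^ (-b)) (Set.Ioi 0) := by
  have hmeas : Measurable fun x : ℝ => min c x ^ a * x ^ (-b) := by fun_prop
  rw [← Set.Ioc_union_Ioi_eq_Ioi zero_le_one]
  refine IntegrableOn.union ?_ ?_
  · have hint : IntegrableOn (fun x : ℝ => x ^ (a - b)) (Set.Ioc 0 1) := by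
      rw [← intervalIntegrable_iff_integrableOn_Ioc_of_le zero_le_one]
      exact intervalIntegral.intervalIntegrable_rpow' (by linarith)
    refine hint.mono' hmeas.aestronglyMeasurable ?_
    filter_upwards [ae_restrict_mem measurableSet_Ioc] with x hx
    have hx0 : 0 < x := hx.1
    rw [Real.norm_of_nonneg (by positivity), sub_eq_add_neg, Real.rpow_add hx0]
    gcongr
    exact min_le_right c x
  · have hint : IntegrableOn (fun x : ℝ => c ^ a * x ^ (-b)) (Set.Ioi 1) :=
      (integrableOn_Ioi_rpow_of_lt (by linarith) one_pos).const_mul _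
    refine hint.mono' hmeas.aestronglyMeasurable ?_
    filter_upwards [ae_restrict_mem measurableSet_Ioi] with x hx
    have hx0 : 0 < x := one_pos.trans hx
    rw [Real.norm_of_nonneg (by positivity)]
    gcongr
    exact min_le_left c x

/-- An even function of `ξ` dominating `|f_t(ξ) - f_s(ξ)|` whenever `|t - s| ≤ h`, where `f_t` is
the kernel of the harmonizable fractional stable motion. It makes the `L^α` norm of all the
increments of the kernel over a step `h` comparable to that of a single function. -/
noncomputable def hfsmEnvelope (H α h ξ : ℝ) : ℝ :=
  min 2 (h * |ξ|) * |ξ| ^ (-(H + 1 / α))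

lemma hfsmEnvelope_nonneg {H α h : ℝ} (hh : 0 ≤ h) (ξ : ℝ) : 0 ≤ hfsmEnvelope H α h ξ := by
  unfold hfsmEnvelope
  positivity

lemma measurable_hfsmEnvelope (H α h : ℝ) : Measurable (hfsmEnvelope H α h) := by
  unfold hfsmEnvelope
  fun_prop

lemma measurable_hfsmKernel (H α t : ℝ) : Measurable (hfsmKernel H α t) := by
  unfold hfsmKernel
  fun_prop

lemma norm_hfsmKernel_sub_le {H α h t s : ℝ} (hts : |t - s| ≤ h) (ξ : ℝ) :
    ‖hfsmKernel H α t ξ - hfsmKernel H α s ξ‖ ≤ hfsmEnvelope H α h ξ := by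
  rw [hfsmKernel, hfsmKernel, ← sub_div, sub_sub_sub_cancel_right, norm_div, Complex.norm_real,
    Real.norm_of_nonneg (by positivity), hfsmEnvelope, Real.rpow_neg (abs_nonneg ξ), div_eq_mul_inv,
    mul_assoc, mul_assoc, ← Complex.ofReal_mul, ← Complex.ofReal_mul]
  gcongr
  refine (norm_exp_I_mul_ofReal_sub_exp_le _ _).trans (min_le_min_left 2 ?_)
  rw [← sub_mul, abs_mul]
  gcongr

lemma memLp_hfsmEnvelope_one {H α : ℝ} (hH : H ∈ Set.Ioo 0 1) (hα : 0 < α) :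
    MemLp (hfsmEnvelope H α 1) (ENNReal.ofReal α) := by
  rw [← integrable_norm_rpow_iff (measurable_hfsmEnvelope H α 1).aestronglyMeasurable
    (by simpa using hα) ENNReal.ofReal_ne_top, ENNReal.toReal_ofReal hα.le]
  have hnorm : ∀ ξ, ‖hfsmEnvelope H α 1 ξ‖ ^ α = min 2 ‖ξ‖ ^ α * ‖ξ‖ ^ (-(H * α + 1)) := fun ξ => by
    rw [Real.norm_of_nonneg (hfsmEnvelope_nonneg zero_le_one ξ), hfsmEnvelope, one_mul,
      Real.mul_rpow (by positivity) (by positivity), ← Real.rpow_mul (abs_nonneg ξ),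
      Real.norm_eq_abs]
    field_simp
  simp_rw [hnorm]
  rw [integrable_fun_norm_addHaar volume (f := fun r => min 2 r ^ α * r ^ (-(H * α + 1)))]
  simpa using integrableOn_Ioi_min_rpow_mul_rpow (b := H * α + 1) zero_le_two hα.le
    (by linarith [mul_pos hH.1 hα]) (by nlinarith [hH.2])

lemma eLpNorm_hfsmEnvelope {H α h : ℝ} (hα : 0 < α) (hh : 0 < h) :
    eLpNorm (hfsmEnvelope H α h) (ENNReal.ofReal α) =
      ENNReal.ofReal (h ^ H) * eLpNorm (hfsmEnvelope H α 1) (ENNReal.ofReal α) := by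
  have hscale : hfsmEnvelope H α h =
      h ^ (H + 1 / α) • fun ξ => hfsmEnvelope H α 1 (h * ξ) := by
    ext ξ
    rw [Pi.smul_apply, smul_eq_mul, hfsmEnvelope, hfsmEnvelope, abs_mul, abs_of_pos hh, one_mul,
      Real.mul_rpow hh.le (abs_nonneg _), Real.rpow_neg hh.le]
    field_simp
  rw [hscale, eLpNorm_const_smul, Real.enorm_of_nonneg (by positivity),
    eLpNorm_comp_mul_left (measurable_hfsmEnvelope H α 1).aestronglyMeasurable
      ENNReal.ofReal_ne_top hh, ENNReal.toReal_ofReal hα.le, ← mul_assoc,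
    ← ENNReal.ofReal_mul (by positivity), ← Real.rpow_add hh, add_neg_cancel_right]

lemma exists_eLpNorm_hfsmEnvelope_le {H α : ℝ} (hH : H ∈ Set.Ioo 0 1) (hα : 0 < α) :
    ∃ C : ℝ, 0 ≤ C ∧ ∀ h : ℝ, 0 < h →
      eLpNorm (hfsmEnvelope H α h) (ENNReal.ofReal α) ≤ ENNReal.ofReal (C * h ^ H) := by
  refine ⟨(eLpNorm (hfsmEnvelope H α 1) (ENNReal.ofReal α)).toReal, ENNReal.toReal_nonneg,
    fun h hh => ?_⟩
  rw [eLpNorm_hfsmEnvelope hα hh, ENNReal.ofReal_mul ENNReal.toReal_nonneg,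
    ENNReal.ofReal_toReal (memLp_hfsmEnvelope_one hH hα).2.ne, mul_comm]

end Kernel

section Summability

lemma summable_two_pow_mul_exp {α a c A : ℝ} {N : ℕ → ℝ} (ha : α < a + 1)
    (hN0 : ∀ n, 0 ≤ N n) (hN : ∀ n, N n ≤ A * 2 ^ n) :
    Summable fun n : ℕ => N n * Real.exp (-(3 * n) + c * ((n : ℝ) ^ (-a) * (3 * n) ^ α)) := by
  have hgeometric : Summable fun n : ℕ => A * (2 * Real.exp (-2)) ^ n := by
    refine (summable_geometric_of_lt_one (by positivity) ?_).mul_left A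
    rw [Real.exp_neg, mul_inv_lt_iff₀ (Real.exp_pos _)]
    linarith [Real.add_one_le_exp 2]
  have hlim : Tendsto (fun n : ℕ => c * 3 ^ α * (n : ℝ) ^ (-(a + 1 - α))) atTop (𝓝 0) := by
    simpa [Function.comp_def] using ((tendsto_rpow_neg_atTop (by linarith : 0 < a + 1 - α)).comp
      tendsto_natCast_atTop_atTop).const_mul (c * 3 ^ α)
  refine hgeometric.of_norm_bounded_eventually_nat ?_
  filter_upwards [hlim.eventually_le_const zero_lt_one, eventually_gt_atTop 0] with n hn hn0
  have hn0' : (0 : ℝ) < n := by exact_mod_cast hn0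
  have hexponent : c * ((n : ℝ) ^ (-a) * (3 * n) ^ α) ≤ n :=
    calc c * ((n : ℝ) ^ (-a) * (3 * n) ^ α)
        = c * 3 ^ α * ((n : ℝ) ^ (-a) * (n : ℝ) ^ α) := by
          rw [Real.mul_rpow (by norm_num) hn0'.le]
          ring
      _ = c * 3 ^ α * (n : ℝ) ^ (-(a + 1 - α)) * n := by
          rw [mul_assoc _ _ (n : ℝ), ← Real.rpow_add_one hn0'.ne', ← Real.rpow_add hn0']
          ring_nf
      _ ≤ 1 * n := by gcongr
      _ = n := one_mul _
  rw [Real.norm_of_nonneg (mul_nonneg (hN0 n) (Real.exp_pos _).le)]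
  calc N n * Real.exp (-(3 * n) + c * ((n : ℝ) ^ (-a) * (3 * n) ^ α))
      ≤ A * 2 ^ n * Real.exp (n * (-2)) := by
        have := (hN0 n).trans (hN n)
        gcongr
        · exact hN n
        · linarith
    _ = A * (2 * Real.exp (-2)) ^ n := by rw [Real.exp_nat_mul, mul_pow, mul_assoc]

lemma summable_rpow_neg_mul_rpow {a c : ℝ} (ha : 1 < a) (hc : 0 ≤ c) :
    Summable fun n : ℕ => (c * ((n : ℝ) ^ (-a) * n)) ^ (2 / (a - 1)) := by
  have hsquare : Summable fun n : ℕ => c ^ (2 / (a - 1)) * (n : ℝ) ^ (-2 : ℝ) :=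
    (Real.summable_nat_rpow.2 (by norm_num)).mul_left _
  refine hsquare.congr_atTop ?_
  filter_upwards [eventually_gt_atTop 0] with n hn
  have hn' : (0 : ℝ) < n := by exact_mod_cast hn
  have ha' : a - 1 ≠ 0 := by linarith
  rw [← Real.rpow_add_one hn'.ne', Real.mul_rpow hc (by positivity), ← Real.rpow_mul hn'.le]
  congr 2
  field_simp
  ring

lemma exists_summable_maximalBound {α a K A : ℝ} {N : ℕ → ℝ} (hα : α < 2) (ha : 1 < a)
    (hK : 0 ≤ K) (hN0 : ∀ n, 0 ≤ N n) (hN : ∀ n, N n ≤ A * 2 ^ n) :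
    ∃ R : ℝ, 0 ≤ R ∧ Summable fun n : ℕ =>
      maximalBound α (N n) (3 * n) R (K * (n : ℝ) ^ (-a)) := by
  have hlarge : Summable fun n : ℕ => K * (n : ℝ) ^ (-a) :=
    (Real.summable_nat_rpow.2 (by linarith)).mul_left K
  have hsmall := (summable_two_pow_mul_exp (α := α) (a := a) (c := 2 / (2 - α) * K) (by linarith)
    hN0 hN).mul_left 2
  have hmiddle := (summable_rpow_neg_mul_rpow (c := 2 / (2 - α) * K * 3) ha
    (mul_nonneg (mul_nonneg (div_nonneg zero_le_two (by linarith)) hK) zero_le_three)).mul_left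
    (Real.exp 1)
  -- The intermediate term is of order `n ^ (-(a - 1) * R)`, that is `n ^ (-2)` for this `R`.
  refine ⟨2 / (a - 1), div_nonneg zero_le_two (by linarith),
    ((hlarge.add hsmall).add hmiddle).congr fun n => ?_⟩
  rw [maximalBound]
  ring_nf

end Summability

section DyadicChaining

/-- The largest multiple of `2⁻ⁿ` not exceeding `s`: the level `n` point of the dyadic chain
leading to `s`. -/
noncomputable def dyadicFloor (n : ℕ) (s : ℝ) : ℝ := ⌊2 ^ n * s⌋ / 2 ^ n

lemma dyadicFloor_le (n : ℕ) (s : ℝ) : dyadicFloor n s ≤ s :=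
  (div_le_iff₀' (by positivity)).2 (Int.floor_le _)

lemma lt_dyadicFloor_add (n : ℕ) (s : ℝ) : s < dyadicFloor n s + (1 / 2) ^ n := by
  rw [dyadicFloor, one_div, inv_pow, ← one_div, ← add_div, lt_div_iff₀' (by positivity)]
  exact Int.lt_floor_add_one _

lemma tendsto_dyadicFloor (s : ℝ) : Tendsto (fun n => dyadicFloor n s) atTop (𝓝 s) := by
  have hpow : Tendsto (fun n : ℕ => s - (1 / 2 : ℝ) ^ n) atTop (𝓝 (s - 0)) :=
    tendsto_const_nhds.sub (tendsto_pow_atTop_nhds_zero_of_lt_one (by norm_num) (by norm_num))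
  rw [sub_zero] at hpow
  exact tendsto_of_tendsto_of_tendsto_of_le_of_le hpow tendsto_const_nhds
    (fun n => sub_le_iff_le_add.2 (lt_dyadicFloor_add n s).le) fun n => dyadicFloor_le n s

lemma floor_two_pow_succ_mul (n : ℕ) (s : ℝ) :
    ⌊2 ^ (n + 1) * s⌋ = 2 * ⌊2 ^ n * s⌋ ∨ ⌊2 ^ (n + 1) * s⌋ = 2 * ⌊2 ^ n * s⌋ + 1 := by
  have hle := Int.floor_le (2 ^ n * s)
  have hlt := Int.lt_floor_add_one (2 ^ n * s)
  have hdouble : (2 : ℝ) ^ (n + 1) * s = 2 * (2 ^ n * s) := by ring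
  have hge : 2 * ⌊2 ^ n * s⌋ ≤ ⌊2 ^ (n + 1) * s⌋ :=
    Int.le_floor.2 (by push_cast; linarith)
  have hlt' : ⌊2 ^ (n + 1) * s⌋ < 2 * ⌊2 ^ n * s⌋ + 2 :=
    Int.floor_lt.2 (by push_cast; linarith)
  lia

lemma abs_floor_two_pow_mul_le {N : ℕ} {s : ℝ} (hs : |s| ≤ N) (n : ℕ) :
    |⌊2 ^ n * s⌋| ≤ N * 2 ^ n := by
  obtain ⟨hge, hle⟩ := abs_le.1 hs
  refine abs_le.2 ⟨Int.le_floor.2 ?_, Int.floor_le_iff.2 ?_⟩ <;> push_cast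
  · nlinarith [pow_pos two_pos n (M₀ := ℝ)]
  · nlinarith [pow_pos two_pos n (M₀ := ℝ)]

variable {E : Type*} [PseudoMetricSpace E] {x : ℝ → E} {N n : ℕ}

lemma dist_le_of_eq_or_eq_add_one {d : ℝ}
    (hd : ∀ k : ℤ, |k| ≤ N * 2 ^ n → dist (x ((k + 1) / 2 ^ n)) (x (k / 2 ^ n)) ≤ d) {k j : ℤ}
    (hk : |k| ≤ N * 2 ^ n) (hj : j = k ∨ j = k + 1) :
    dist (x (j / 2 ^ n)) (x (k / 2 ^ n)) ≤ d := by
  have hstep := hd k hk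
  rcases hj with rfl | rfl
  · exact (dist_self _).trans_le (dist_nonneg.trans hstep)
  · exact_mod_cast hstep

lemma dist_dyadicFloor_succ_le {d : ℝ}
    (hd : ∀ k : ℤ, |k| ≤ N * 2 ^ (n + 1) →
      dist (x ((k + 1) / 2 ^ (n + 1))) (x (k / 2 ^ (n + 1))) ≤ d)
    {s : ℝ} (hs : |s| ≤ N) : dist (x (dyadicFloor (n + 1) s)) (x (dyadicFloor n s)) ≤ d := by
  have hfloor : dyadicFloor n s = (2 * ⌊2 ^ n * s⌋ : ℤ) / 2 ^ (n + 1) := by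
    rw [dyadicFloor, pow_succ]
    push_cast
    field_simp
  have habs : |2 * ⌊2 ^ n * s⌋| ≤ N * 2 ^ (n + 1) := by
    rw [abs_mul, abs_two, pow_succ]
    linarith [abs_floor_two_pow_mul_le hs n]
  rw [hfloor]
  exact dist_le_of_eq_or_eq_add_one hd habs (floor_two_pow_succ_mul n s)

lemma dist_dyadicFloor_dyadicFloor_le {d : ℝ}
    (hd : ∀ k : ℤ, |k| ≤ N * 2 ^ n → dist (x ((k + 1) / 2 ^ n)) (x (k / 2 ^ n)) ≤ d) {s t : ℝ}
    (hs : |s| ≤ N) (hst : s ≤ t) (hts : t - s ≤ (1 / 2) ^ n) :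
    dist (x (dyadicFloor n t)) (x (dyadicFloor n s)) ≤ d := by
  refine dist_le_of_eq_or_eq_add_one hd (abs_floor_two_pow_mul_le hs n) ?_
  have hge : ⌊2 ^ n * s⌋ ≤ ⌊2 ^ n * t⌋ := Int.floor_mono (by gcongr)
  have hle : ⌊2 ^ n * t⌋ ≤ ⌊2 ^ n * s⌋ + 1 := by
    rw [← Int.floor_add_one]
    refine Int.floor_mono ?_
    have hpow : (2 : ℝ) ^ n * (1 / 2) ^ n = 1 := by rw [← mul_pow]; norm_num
    nlinarith [pow_pos two_pos n (M₀ := ℝ)]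
  lia

variable {d : ℕ → ℝ}

lemma dist_dyadicFloor_le_tsum {s : ℝ} (hx : ContinuousAt x s)
    (hd : ∀ p > n, ∀ k : ℤ, |k| ≤ N * 2 ^ p →
      dist (x ((k + 1) / 2 ^ p)) (x (k / 2 ^ p)) ≤ d p)
    (hsum : Summable fun i => d (n + (i + 1))) (hs : |s| ≤ N) :
    dist (x (dyadicFloor n s)) (x s) ≤ ∑' i, d (n + (i + 1)) := by
  refine dist_le_tsum_of_dist_le_of_tendsto₀ (f := fun i => x (dyadicFloor (n + i) s)) _
    (fun i => ?_) hsum ?_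
  · rw [dist_comm]
    exact dist_dyadicFloor_succ_le (hd (n + (i + 1)) (by lia)) hs
  · have hshift : Tendsto (fun i => n + i) atTop atTop :=
      tendsto_atTop_mono (fun i => Nat.le_add_left i n) tendsto_id
    exact hx.tendsto.comp ((tendsto_dyadicFloor s).comp hshift)

lemma dist_le_two_mul_tsum_of_dyadic (hx : Continuous x)
    (hd : ∀ p ≥ n, ∀ k : ℤ, |k| ≤ N * 2 ^ p →
      dist (x ((k + 1) / 2 ^ p)) (x (k / 2 ^ p)) ≤ d p)
    (hsum : Summable fun i => d (n + i)) {s t : ℝ} (hs : |s| ≤ N) (ht : |t| ≤ N) (hst : s ≤ t)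
    (hts : t - s ≤ (1 / 2) ^ n) : dist (x t) (x s) ≤ 2 * ∑' i, d (n + i) := by
  have hsum' : Summable fun i => d (n + (i + 1)) := (summable_nat_add_iff 1).2 hsum
  have hchain : ∀ u : ℝ, |u| ≤ N → dist (x (dyadicFloor n u)) (x u) ≤ ∑' i, d (n + (i + 1)) :=
    fun u hu => dist_dyadicFloor_le_tsum hx.continuousAt (fun p hp => hd p hp.le) hsum' hu
  have hlevel : dist (x (dyadicFloor n t)) (x (dyadicFloor n s)) ≤ d n :=
    dist_dyadicFloor_dyadicFloor_le (hd n le_rfl) hs hst hts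
  rw [hsum.tsum_eq_zero_add, add_zero]
  have htriangle := dist_triangle4 (x t) (x (dyadicFloor n t)) (x (dyadicFloor n s)) (x s)
  rw [dist_comm (x t) (x (dyadicFloor n t))] at htriangle
  linarith [hchain s hs, hchain t ht, dist_nonneg.trans hlevel]

lemma exists_forall_dist_le_mul_of_local {I : Set ℝ} (hI : IsCompact I) (hx : ContinuousOn x I)
    {w : ℝ → ℝ} (hw : ContinuousOn w (Set.Ioi 0)) (hw0 : ∀ h, 0 < h → 0 < w h) {η K : ℝ}
    (hη : 0 < η)
    (hlocal : ∀ s ∈ I, ∀ t ∈ I, s < t → t - s ≤ η → dist (x t) (x s) ≤ K * w (t - s)) :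
    ∃ K', ∀ s ∈ I, ∀ t ∈ I, s < t → dist (x t) (x s) ≤ K' * w (t - s) := by
  have hcompact : IsCompact (I ×ˢ I ∩ {p | η ≤ p.2 - p.1}) :=
    (hI.prod hI).inter_right (isClosed_le (by fun_prop) (by fun_prop))
  have hquotient : ContinuousOn (fun p : ℝ × ℝ => dist (x p.2) (x p.1) / w (p.2 - p.1))
      (I ×ˢ I ∩ {p | η ≤ p.2 - p.1}) := by
    refine ContinuousOn.div ?_ ?_ fun p hp => (hw0 _ (hη.trans_le hp.2)).ne'
    · exact continuous_dist.comp_continuousOn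
        ((hx.comp continuousOn_snd fun p hp => hp.1.2).prodMk
          (hx.comp continuousOn_fst fun p hp => hp.1.1))
    · exact hw.comp (by fun_prop) fun p hp => hη.trans_le hp.2
  obtain ⟨B, hB⟩ := hcompact.exists_bound_of_continuousOn hquotient
  refine ⟨max K B, fun s hs t ht hst => ?_⟩
  have hwpos := hw0 (t - s) (sub_pos.2 hst)
  rcases le_total (t - s) η with hsmall | hlarge
  · grw [hlocal s hs t ht hst hsmall, ← le_max_left K B]
  · grw [← le_max_right K B]
    exact (div_le_iff₀ hwpos).1 ((le_abs_self _).trans (hB (s, t) ⟨⟨hs, ht⟩, hlarge⟩))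

end DyadicChaining

section DyadicModulus

variable {H β : ℝ}

/-- The modulus of continuity `h ^ H * (log h⁻¹) ^ β` at `h = 2⁻ⁿ`, up to a constant factor. -/
noncomputable def dyadicModulus (H β : ℝ) (n : ℕ) : ℝ := ((1 / 2 : ℝ) ^ n) ^ H * (n : ℝ) ^ β

lemma dyadicModulus_nonneg (H β : ℝ) (n : ℕ) : 0 ≤ dyadicModulus H β n := by
  unfold dyadicModulus
  positivity

lemma dyadicModulus_add_le (hβ : 0 ≤ β) {n : ℕ} (hn : 1 ≤ n) (i : ℕ) :
    dyadicModulus H β (n + i) ≤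
      dyadicModulus H β n * (((1 / 2 : ℝ) ^ H) ^ i * ((i : ℝ) + 1) ^ β) := by
  have hpow : ((1 / 2 : ℝ) ^ (n + i)) ^ H = ((1 / 2 : ℝ) ^ n) ^ H * ((1 / 2 : ℝ) ^ H) ^ i := by
    rw [pow_add, Real.mul_rpow (by positivity) (by positivity), Real.rpow_pow_comm (by norm_num)]
  have hrpow : ((n + i : ℕ) : ℝ) ^ β ≤ (n : ℝ) ^ β * ((i : ℝ) + 1) ^ β := by
    have hn' : (1 : ℝ) ≤ n := by exact_mod_cast hn
    rw [← Real.mul_rpow (by positivity) (by positivity)]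
    gcongr
    push_cast
    nlinarith [i.cast_nonneg (α := ℝ)]
  rw [dyadicModulus, dyadicModulus, hpow, mul_mul_mul_comm]
  gcongr

lemma summable_geometric_mul_rpow {r : ℝ} (hr0 : 0 ≤ r) (hr1 : r < 1) (β : ℝ) :
    Summable fun i : ℕ => r ^ i * ((i : ℝ) + 1) ^ β := by
  rcases hr0.eq_or_lt with rfl | hr
  · exact summable_of_ne_finset_zero (s := {0}) fun i hi => by simp_all
  have hpoly := ((summable_nat_add_iff 1).2 (summable_pow_mul_geometric_of_norm_lt_one ⌈β⌉₊
    (r := r) (by rwa [Real.norm_of_nonneg hr0]))).mul_left r⁻¹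
  refine Summable.of_nonneg_of_le (fun i => by positivity) (fun i => ?_) hpoly
  have hceil : ((i : ℝ) + 1) ^ β ≤ ((i : ℝ) + 1) ^ ⌈β⌉₊ := by
    rw [← Real.rpow_natCast]
    exact Real.rpow_le_rpow_of_exponent_le (by linarith [i.cast_nonneg (α := ℝ)]) (Nat.le_ceil β)
  grw [hceil]
  refine le_of_eq ?_
  push_cast
  field_simp
  ring

lemma exists_tsum_dyadicModulus_le (hH : 0 < H) (hβ : 0 ≤ β) :
    ∃ S : ℝ, 0 ≤ S ∧ ∀ n ≥ 1, (Summable fun i => dyadicModulus H β (n + i)) ∧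
      ∑' i, dyadicModulus H β (n + i) ≤ S * dyadicModulus H β n := by
  have hsum : Summable fun i : ℕ => ((1 / 2 : ℝ) ^ H) ^ i * ((i : ℝ) + 1) ^ β :=
    summable_geometric_mul_rpow (by positivity)
      (Real.rpow_lt_one (by norm_num) (by norm_num) hH) β
  refine ⟨∑' i : ℕ, ((1 / 2 : ℝ) ^ H) ^ i * ((i : ℝ) + 1) ^ β,
    tsum_nonneg fun i => by positivity, fun n hn => ?_⟩
  have hsum' : Summable fun i => dyadicModulus H β (n + i) :=
    Summable.of_nonneg_of_le (fun i => dyadicModulus_nonneg H β _) (dyadicModulus_add_le hβ hn)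
      (hsum.mul_left _)
  refine ⟨hsum', ?_⟩
  rw [mul_comm, ← tsum_mul_left]
  exact hsum'.tsum_le_tsum (dyadicModulus_add_le hβ hn) (hsum.mul_left _)

lemma dyadicModulus_le (hH : 0 ≤ H) (hβ : 0 ≤ β) {n : ℕ} {h : ℝ} (hh : 0 < h)
    (hlt : (1 / 2 : ℝ) ^ (n + 1) < h) (hle : h ≤ (1 / 2 : ℝ) ^ n) :
    dyadicModulus H β n ≤ 2 ^ H * (Real.log 2)⁻¹ ^ β * (h ^ H * Real.log (1 + h⁻¹) ^ β) := by
  have hlog2 : 0 < Real.log 2 := Real.log_pos one_lt_two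
  have hlog : (n : ℝ) ≤ (Real.log 2)⁻¹ * Real.log (1 + h⁻¹) := by
    have hpow : (2 : ℝ) ^ n ≤ h⁻¹ := by
      rwa [le_inv_comm₀ (by positivity) hh, ← inv_pow, ← one_div]
    rw [le_inv_mul_iff₀ hlog2, mul_comm, ← Real.log_pow]
    exact Real.log_le_log (by positivity) (by linarith)
  calc dyadicModulus H β n ≤ (2 * h) ^ H * ((Real.log 2)⁻¹ * Real.log (1 + h⁻¹)) ^ β := by
        rw [dyadicModulus]
        gcongr
        linarith [pow_succ (1 / 2 : ℝ) n]
    _ = 2 ^ H * (Real.log 2)⁻¹ ^ β * (h ^ H * Real.log (1 + h⁻¹) ^ β) := by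
        have hlogh : 0 ≤ Real.log (1 + h⁻¹) := Real.log_nonneg (by linarith [inv_pos.2 hh])
        rw [Real.mul_rpow zero_le_two hh.le, Real.mul_rpow (by positivity) hlogh,
          mul_mul_mul_comm]

variable {E : Type*} [PseudoMetricSpace E] {x : ℝ → E} {N n₀ : ℕ} {C : ℝ}

lemma exists_forall_dist_le_of_sub_le (hx : Continuous x) (hC : 0 ≤ C) (hH : 0 < H)
    (hβ : 0 ≤ β)
    (hd : ∀ n ≥ n₀, ∀ k : ℤ, |k| ≤ N * 2 ^ n →
      dist (x ((k + 1) / 2 ^ n)) (x (k / 2 ^ n)) ≤ C * dyadicModulus H β n) :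
    ∃ η K : ℝ, 0 < η ∧ ∀ s t : ℝ, |s| ≤ N → |t| ≤ N → s < t → t - s ≤ η →
      dist (x t) (x s) ≤ K * ((t - s) ^ H * Real.log (1 + (t - s)⁻¹) ^ β) := by
  obtain ⟨S, hS, hsum⟩ := exists_tsum_dyadicModulus_le hH hβ
  refine ⟨(1 / 2) ^ max n₀ 1, 2 * (C * (S * (2 ^ H * (Real.log 2)⁻¹ ^ β))), by positivity,
    fun s t hs ht hst hη => ?_⟩
  have hpos : 0 < t - s := sub_pos.2 hst
  obtain ⟨n, hlt, hle⟩ := exists_nat_pow_near_of_lt_one hpos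
    (hη.trans (pow_le_one₀ (by norm_num) (by norm_num))) (by norm_num : (0 : ℝ) < 1 / 2)
    (by norm_num)
  have hn : max n₀ 1 ≤ n := Nat.lt_succ_iff.1 <|
    (pow_lt_pow_iff_right_of_lt_one₀ (by norm_num : (0 : ℝ) < 1 / 2) (by norm_num)).1
      (hlt.trans_le hη)
  obtain ⟨hn₀, hn1⟩ := max_le_iff.1 hn
  obtain ⟨hsummable, htsum⟩ := hsum n hn1
  calc dist (x t) (x s) ≤ 2 * ∑' i, C * dyadicModulus H β (n + i) :=
        dist_le_two_mul_tsum_of_dyadic hx (d := fun p => C * dyadicModulus H β p)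
          (fun p hp => hd p (hn₀.trans hp)) (hsummable.mul_left C) hs ht hst.le hle
    _ ≤ 2 * (C * (S * (2 ^ H * (Real.log 2)⁻¹ ^ β *
          ((t - s) ^ H * Real.log (1 + (t - s)⁻¹) ^ β)))) := by
        rw [tsum_mul_left]
        grw [htsum, dyadicModulus_le hH.le hβ hpos hlt hle]
    _ = 2 * (C * (S * (2 ^ H * (Real.log 2)⁻¹ ^ β))) *
          ((t - s) ^ H * Real.log (1 + (t - s)⁻¹) ^ β) := by ring

theorem exists_forall_dist_le_of_dyadic (hx : Continuous x) (hC : 0 ≤ C) (hH : 0 < H)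
    (hβ : 0 ≤ β)
    (hd : ∀ n ≥ n₀, ∀ k : ℤ, |k| ≤ N * 2 ^ n →
      dist (x ((k + 1) / 2 ^ n)) (x (k / 2 ^ n)) ≤ C * dyadicModulus H β n) :
    ∃ K : ℝ, ∀ s t : ℝ, |s| ≤ N → |t| ≤ N → s < t →
      dist (x t) (x s) ≤ K * ((t - s) ^ H * Real.log (1 + (t - s)⁻¹) ^ β) := by
  obtain ⟨η, K, hη, hlocal⟩ := exists_forall_dist_le_of_sub_le hx hC hH hβ hd
  have hlog : ∀ h : ℝ, 0 < h → 0 < Real.log (1 + h⁻¹) := fun h hh =>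
    Real.log_pos (by linarith [inv_pos.2 hh])
  have hmodulus : ContinuousOn (fun h : ℝ => h ^ H * Real.log (1 + h⁻¹) ^ β) (Set.Ioi 0) := by
    intro h hh
    have hh0 : h ≠ 0 := (Set.mem_Ioi.1 hh).ne'
    have hlog0 := (hlog h hh).ne'
    have hne : 1 + h⁻¹ ≠ 0 := by linarith [inv_pos.2 (Set.mem_Ioi.1 hh)]
    exact ContinuousAt.continuousWithinAt (by fun_prop (disch := simp_all))
  obtain ⟨K', hK'⟩ := exists_forall_dist_le_mul_of_local (isCompact_closedBall (0 : ℝ) N)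
    hx.continuousOn hmodulus (fun h hh => by have := hlog h hh; positivity) hη
    (K := K) (fun s hs t ht => hlocal s t (by simpa using hs) (by simpa using ht))
  exact ⟨K', fun s t hs ht => hK' s (by simpa using hs) t (by simpa using ht)⟩

end DyadicModulus

section DyadicIncrements

lemma card_Icc_neg_le (N n : ℕ) :
    (Fintype.card (Finset.Icc (-(N * 2 ^ n) : ℤ) (N * 2 ^ n)) : ℝ) ≤ (2 * N + 1) * 2 ^ n := by
  have hnonneg : (0 : ℤ) ≤ N * 2 ^ n := by positivity
  have hcard : (Fintype.card (Finset.Icc (-(N * 2 ^ n) : ℤ) (N * 2 ^ n)) : ℤ) =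
      2 * (N * 2 ^ n) + 1 := by
    rw [Fintype.card_coe, Int.card_Icc, Int.toNat_of_nonneg (by linarith)]
    ring
  have hcard' : (Fintype.card (Finset.Icc (-(N * 2 ^ n) : ℤ) (N * 2 ^ n)) : ℝ) =
      2 * (N * 2 ^ n) + 1 := by exact_mod_cast hcard
  rw [hcard']
  linarith [one_le_pow₀ (one_le_two (α := ℝ)) (n := n)]

lemma mul_rpow_dyadicModulus_neg {H α δ C : ℝ} (hα : 0 < α) (hC : 0 ≤ C) {n : ℕ} (hn : 1 ≤ n) :
    (C * ((1 / 2 : ℝ) ^ n) ^ H) ^ α * dyadicModulus H (1 / α + δ) n ^ (-α) =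
      C ^ α * (n : ℝ) ^ (-(1 + α * δ)) := by
  have hn0 : (0 : ℝ) < n := by exact_mod_cast hn
  have hz : 0 < ((1 / 2 : ℝ) ^ n) ^ H := by positivity
  have hexponent : (1 / α + δ) * -α = -(1 + α * δ) := by field_simp
  rw [dyadicModulus, Real.mul_rpow hC hz.le, Real.mul_rpow hz.le (by positivity),
    Real.rpow_neg hz.le, ← Real.rpow_mul hn0.le, hexponent]
  field_simp

variable {Ω : Type*} [MeasurableSpace Ω] {P : Measure Ω} [IsProbabilityMeasure P] {H α δ : ℝ}
  {M : Set ℝ → Ω → ℂ} {J : ℝ → Ω → ℂ}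

namespace IsIsotropicStableRandomMeasure

lemma measureReal_exists_lt_abs_dyadic_increment_le
    (hM : IsIsotropicStableRandomMeasure α volume P M) (hα : α ∈ Set.Ioo 0 2)
    (hJ : ∀ t, IsStableIntegral α volume P M (hfsmKernel H α t) (J t)) {C : ℝ} (hC : 0 ≤ C)
    (henv : ∀ h, 0 < h →
      eLpNorm (hfsmEnvelope H α h) (ENNReal.ofReal α) ≤ ENNReal.ofReal (C * h ^ H))
    (s : Finset ℤ) {n : ℕ} (hn : 1 ≤ n) {L R : ℝ} (hL : 0 < L) (hR : 0 ≤ R) :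
    P.real {ω | ∃ k : s, (R + 2) * dyadicModulus H (1 / α + δ) n <
        |(J ((k + 1) / 2 ^ n) ω - J (k / 2 ^ n) ω).re|} ≤
      maximalBound α (Fintype.card s) L R
        ((4 * 4 ^ α * (2 * C) ^ α + 1) * (n : ℝ) ^ (-(1 + α * δ))) := by
  have hn0 : (0 : ℝ) < n := by exact_mod_cast hn
  have hpow : (0 : ℝ) < (1 / 2) ^ n := by positivity
  refine hM.measureReal_exists_lt_abs_re_le hα
    (f := fun (k : s) ξ => hfsmKernel H α ((k + 1) / 2 ^ n) ξ - hfsmKernel H α (k / 2 ^ n) ξ)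
    (fun k => (measurable_hfsmKernel _ _ _).sub (measurable_hfsmKernel _ _ _))
    (fun k => IsStableIntegral.sub hM (measurable_hfsmKernel _ _ _).aestronglyMeasurable
      (measurable_hfsmKernel _ _ _).aestronglyMeasurable (hJ _) (hJ _))
    (a := C * ((1 / 2 : ℝ) ^ n) ^ H) (by positivity) ?_ (by unfold dyadicModulus; positivity)
    hL hR (by positivity) ?_
  · refine (eLpNorm_mono_real fun ξ => ?_).trans (henv _ hpow)
    refine (pi_norm_le_iff_of_nonneg (hfsmEnvelope_nonneg hpow.le ξ)).2 fun k =>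
      norm_hfsmKernel_sub_le (le_of_eq ?_) ξ
    rw [← sub_div, add_sub_cancel_left, abs_of_pos (by positivity), one_div, one_div, inv_pow]
  · rw [← mul_assoc 2, mul_assoc, mul_rpow_dyadicModulus_neg hα.1 (by positivity) hn, ← mul_assoc]
    gcongr
    linarith

theorem exists_ae_eventually_dyadic_increment_le
    (hM : IsIsotropicStableRandomMeasure α volume P M) (hH : H ∈ Set.Ioo 0 1)
    (hα : α ∈ Set.Ioo 0 2) (hδ : 0 < δ) (N : ℕ)
    (hJ : ∀ t, IsStableIntegral α volume P M (hfsmKernel H α t) (J t)) :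
    ∃ C : ℝ, 0 ≤ C ∧ ∀ᵐ ω ∂P, ∀ᶠ n : ℕ in atTop, ∀ k : ℤ, |k| ≤ N * 2 ^ n →
      |(J ((k + 1) / 2 ^ n) ω).re - (J (k / 2 ^ n) ω).re| ≤
        C * dyadicModulus H (1 / α + δ) n := by
  obtain ⟨C, hC, henv⟩ := exists_eLpNorm_hfsmEnvelope_le hH hα.1
  have hαδ : 0 < α * δ := mul_pos hα.1 hδ
  obtain ⟨R, hR, hsum⟩ := exists_summable_maximalBound (a := 1 + α * δ)
    (K := 4 * 4 ^ α * (2 * C) ^ α + 1) hα.2 (by linarith) (by positivity)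
    (fun n => Nat.cast_nonneg (Fintype.card (Finset.Icc (-(N * 2 ^ n) : ℤ) (N * 2 ^ n))))
    (card_Icc_neg_le N)
  refine ⟨R + 2, by positivity, ?_⟩
  have hprob : Summable fun n : ℕ => P.real {ω | ∃ k : Finset.Icc (-(N * 2 ^ n) : ℤ) (N * 2 ^ n),
      (R + 2) * dyadicModulus H (1 / α + δ) n <
        |(J ((k + 1) / 2 ^ n) ω - J (k / 2 ^ n) ω).re|} := by
    refine hsum.of_norm_bounded_eventually_nat ?_
    filter_upwards [eventually_ge_atTop 1] with n hn
    rw [Real.norm_of_nonneg measureReal_nonneg]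
    exact hM.measureReal_exists_lt_abs_dyadic_increment_le hα hJ hC henv _ hn (by positivity) hR
  have hfinite := hprob.tsum_ofReal_ne_top
  rw [tsum_congr fun n => ofReal_measureReal] at hfinite
  filter_upwards [ae_eventually_notMem hfinite] with ω hω
  filter_upwards [hω] with n hn k hk
  refine not_lt.1 fun hlt => hn ⟨⟨k, Finset.mem_Icc.2 (abs_le.1 hk)⟩, ?_⟩
  rwa [Complex.sub_re]

end IsIsotropicStableRandomMeasure

end DyadicIncrements

theorem mainTheorem1_general {Ω : Type*} [MeasurableSpace Ω] (P : Measure Ω)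
    [IsProbabilityMeasure P] (H α δ ρ : ℝ) (hH : H ∈ Set.Ioo (0 : ℝ) 1)
    (hα : α ∈ Set.Ioo (0 : ℝ) 2) (hδ : 0 < δ)
    (M : Set ℝ → Ω → ℂ) (X : ℝ → Ω → ℝ) (hX : IsHFSM H α P M X) :
    ∀ᵐ ω ∂P,
      (⨆ (t' : ℝ) (t'' : ℝ) (_ : -ρ ≤ t' ∧ t' < t'' ∧ t'' ≤ ρ),
        ENNReal.ofReal (|X t' ω - X t'' ω| /
          (|t' - t''| ^ H * Real.log (1 + |t' - t''|⁻¹) ^ (1 / α + δ)))) < ∞ := by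
  choose J hJ hXJ using hX.eq_integral
  have hβ : 0 ≤ 1 / α + δ := by have := hα.1; positivity
  obtain ⟨C, hC, hincrement⟩ :=
    hX.randomMeasure.exists_ae_eventually_dyadic_increment_le hH hα hδ ⌈ρ⌉₊ hJ
  have hdyadic : ∀ᵐ ω ∂P, ∀ (n : ℕ) (k : ℤ), X (k / 2 ^ n) ω = (J (k / 2 ^ n) ω).re :=
    ae_all_iff.2 fun n => ae_all_iff.2 fun k => hXJ _
  filter_upwards [hX.continuous, hdyadic, hincrement] with ω hcont hXω hω
  obtain ⟨n₀, hn₀⟩ := eventually_atTop.1 hω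
  obtain ⟨K, hK⟩ := exists_forall_dist_le_of_dyadic hcont hC hH.1 hβ (N := ⌈ρ⌉₊) (n₀ := n₀)
    fun n hn k hk => by
      have hsucc := hXω n (k + 1)
      push_cast at hsucc
      rw [Real.dist_eq, hsucc, hXω]
      exact hn₀ n hn k hk
  refine lt_of_le_of_lt (iSup_le fun s => iSup_le fun t => iSup_le fun ⟨hs, hst, ht⟩ => ?_)
    (ENNReal.ofReal_lt_top (r := K))
  have hρ : ρ ≤ ⌈ρ⌉₊ := Nat.le_ceil ρ
  have hpos : 0 < t - s := sub_pos.2 hst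
  have hlog : 0 < Real.log (1 + (t - s)⁻¹) := Real.log_pos (by linarith [inv_pos.2 hpos])
  rw [abs_sub_comm s, abs_of_pos hpos, abs_sub_comm (X s ω)]
  exact ENNReal.ofReal_le_ofReal ((div_le_iff₀ (by positivity)).2
    (hK s t (abs_le.2 ⟨by linarith [hs], by linarith⟩)
      (abs_le.2 ⟨by linarith, by linarith [ht]⟩) hst))

theorem mainTheorem1 {Ω : Type*} [MeasurableSpace Ω] (P : Measure Ω) [IsProbabilityMeasure P]
    (H α δ ρ : ℝ) (hH : H ∈ Set.Ioo (0 : ℝ) 1) (hα : α ∈ Set.Ico (1 : ℝ) 2)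
    (hδ : 0 < δ) (hρ : 0 < ρ)
    (M : Set ℝ → Ω → ℂ) (X : ℝ → Ω → ℝ) (hX : IsHFSM H α P M X) :
    ∀ᵐ ω ∂P,
      (⨆ (t' : ℝ) (t'' : ℝ) (_ : -ρ ≤ t' ∧ t' < t'' ∧ t'' ≤ ρ),
        ENNReal.ofReal (|X t' ω - X t'' ω| /
          (|t' - t''| ^ H * Real.log (1 + |t' - t''|⁻¹) ^ (1 / α + δ)))) < ∞ :=
  mainTheorem1_general P H α δ ρ hH ⟨by linarith [hα.1], hα.2⟩ hδ M X hX
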